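/- Fields have characteristic different from $2$. For a field $F$ and $b,c\in F^\times$, $(b,c)_F$ denotes the quaternion $F$-algebra with basis $1,i,j,ij$, $i^2=b$, $j^2=c$, $ji=-ij$; a quaternion is pure if its scalar part is $0$; $\bar{\ }$ is the canonical involution. **Proposition.** Let $Q$ be a quaternion division algebra over $F$ containing pure quaternions $q_1,q_2,q_3$ with $q_i^2=a_i\in F^\times$, such that $Q$ is split by $F(\sqrt{a_1a_2})$ but neither by $F(\sqrt{a_1a_3})$ nor by $F(\sqrt{a_2a_3})$. Let $n\ge 3$ be even, put $q_4=\dots=q_n=q_3$, let $\hat F=F((t_1))\cdots((t_n))$ be the field of iterated Laurent series, $\hat Q=Q\otimes_F\hat F$, and let $\sigma$ be the (orthogonal) involution on $A=M_n(\hat Q)$ adjoint to the skew-hermitian form $\langle t_1q_1,\dots,t_nq_n\rangle$ over $(\hat Q,\bar{\ })$. Then: 1. $(A,\sigma)$ has no improper similitude: there is no $g\in A^\times$ with $\sigma(g)g=\mu\in\hat F^\times$ and $\operatorname{Nrd}_A(g)=-\mu^n$. 2. The discriminant of $\sigma$ (the square class of $(-1)^n\operatorname{Nrd}_A(s)$ for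 any $s\in A^\times$ with $\sigma(s)=-s$) is the class $a_1a_2\hat F^{\times 2}$. It is not trivial, so the discriminant algebra $Z=\hat F(\sqrt{\operatorname{disc}\sigma})$ is a quadratic field extension, and $Z$ splits $\hat Q$. **Example.** Let $k$ be a field with $-1\in k^{\times2}$, and let $a_1,a_2\in k^\times$ be such that $(a_1,a_2)_k$ is a division algebra. Let $F=k(r,s,t)$ with independent indeterminates $r,s,t$, $Q=(a_1,a_2)_F$ and $a_3=a_1r^2+a_2s^2+a_1a_2t^2$. Then $a_3\neq0$, $Q$ is a division algebra, and $Q$ contains pure quaternions $q_1,q_2,q_3$ with $q_i^2=a_i$ for $i=1,2,3$; moreover $Q$ is split by $F(\sqrt{a_1a_2})$ but neither by $F(\sqrt{a_1a_3})$ nor by $F(\sqrt{a_2a_3})$. So $Q$ satisfies the conditions of the Proposition. -/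

import Mathlib

open scoped Quaternion TensorProduct

universe u v

noncomputable section

/-! ### Splitting fields of algebras, reduced norms -/

/-- The field `F(√d)` (equal to `F` when `d` is already a square). -/
abbrev SqrtField (F : Type*) [Field F] (d : F) : Type _ :=
  (Polynomial.X ^ 2 - Polynomial.C d : Polynomial F).SplittingField

/-- The `F`-algebra `A` is split by the extension `L` of `F`:
`L ⊗ A` is isomorphic to a matrix algebra over `L`. -/
def IsSplitBy (F : Type*) [Field F] (A : Type*) [Ring A] [Algebra F A]
    (L : Type*) [Field L] [Algebra F L] : Prop :=
  ∃ d : ℕ, Nonempty (L ⊗[F] A ≃ₐ[L] Matrix (Fin d) (Fin d) L)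

/-- `c` is the reduced norm of the element `a` of the central simple `F`-algebra `A`:
`c` is the determinant of `a` in a matrix representation of `A` over a splitting field `L`. -/
def IsReducedNorm {F : Type u} [Field F] {A : Type*} [Ring A] [Algebra F A]
    (a : A) (c : F) : Prop :=
  ∃ (L : Type u) (_ : Field L) (_ : Algebra F L) (d : ℕ)
    (φ : L ⊗[F] A ≃ₐ[L] Matrix (Fin d) (Fin d) L),
    (φ (1 ⊗ₜ[F] a)).det = algebraMap F L c

/-! ### Similitudes and discriminants of orthogonal involutions, characteristic not two -/

/-- `g` is a similitude with multiplier `μ` of the algebra with involution `(A, σ)`. -/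
def IsSimilitude {F : Type*} [Field F] {A : Type*} [Ring A] [Algebra F A]
    (σ : A → A) (g : A) (μ : F) : Prop :=
  IsUnit g ∧ μ ≠ 0 ∧ σ g * g = algebraMap F A μ

/-- `g` is an improper similitude of `(A, σ)`, where `A` is central simple of degree `2 * m` and
`σ` is an orthogonal involution: `Nrd g = - μ ^ m` where `μ` is the multiplier of `g`. -/
def IsImproperSimilitude {F : Type*} [Field F] {A : Type*} [Ring A] [Algebra F A]
    (m : ℕ) (σ : A → A) (g : A) : Prop :=
  ∃ μ : F, IsSimilitude σ g μ ∧ IsReducedNorm g (-μ ^ m)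

/-- The discriminant of the orthogonal involution `σ` on the central simple algebra `A` of degree
`2 * m`: the square class of `(-1) ^ m * Nrd s`, where `s` is any invertible element of `A` with
`σ s = -s`. -/
def involutionDiscriminant {F : Type*} [Field F] {A : Type*} [Ring A] [Algebra F A]
    (m : ℕ) (σ : A → A) : Set F :=
  {δ | ∃ (s : A) (c u : F), IsUnit s ∧ σ s = -s ∧ IsReducedNorm s c ∧ u ≠ 0 ∧
    δ = (-1) ^ m * c * u ^ 2}

/-! ### Diagonal skew-hermitian forms and their adjoint involutions -/

/-- The sesquilinear form `⟨d₁, …, dₙ⟩` on the right `R`-module `Rⁿ`: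
`h(x, y) = ∑ᵢ star xᵢ * dᵢ * yᵢ`. -/
def diagForm {R : Type*} [Ring R] [StarRing R] {n : ℕ} (d x y : Fin n → R) : R :=
  ∑ i, star (x i) * d i * y i

/-- The involution `σ` on `Mₙ(R)` adjoint to the form `⟨d₁, …, dₙ⟩`,
that is `σ g = H⁻¹ * gᴴ * H` where `H = diag(d₁, …, dₙ)`. -/
def diagAdjoint {R : Type*} [Ring R] [StarRing R] {n : ℕ} (d : Fin n → R)
    (g : Matrix (Fin n) (Fin n) R) : Matrix (Fin n) (Fin n) R :=
  Matrix.diagonal (fun i => Ring.inverse (d i)) * g.conjTranspose * Matrix.diagonal d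

/-- `diagAdjoint d` is adjoint to the skew-hermitian form `diagForm d`. -/
theorem diagForm_mulVec {R : Type*} [Ring R] [StarRing R] {n : ℕ} (d : Fin n → R)
    (hd : ∀ i, IsUnit (d i)) (hs : ∀ i, star (d i) = -d i)
    (g : Matrix (Fin n) (Fin n) R) (x y : Fin n → R) :
    diagForm d x (g.mulVec y) = diagForm d ((diagAdjoint d g).mulVec x) y := by
  have key : ∀ i j, star (diagAdjoint d g i j) * d i = d j * g j i := by
    intro i j
    have h1 : star (Ring.inverse (d i)) * d i = -1 := by
      have h2 : star (d i * Ring.inverse (d i)) = 1 := by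
        rw [Ring.mul_inverse_cancel _ (hd i), star_one]
      rw [star_mul, hs] at h2
      rw [← h2]; simp
    simp only [diagAdjoint, Matrix.diagonal_mul, Matrix.mul_diagonal, Matrix.conjTranspose_apply,
      star_mul, star_star, hs]
    rw [mul_assoc, mul_assoc, h1]; simp
  simp only [diagForm, Matrix.mulVec, dotProduct, star_sum, star_mul, Finset.mul_sum,
    Finset.sum_mul]
  rw [Finset.sum_comm]
  refine Finset.sum_congr rfl fun i _ => Finset.sum_congr rfl fun j _ => ?_
  rw [mul_assoc (star (x j)) _ (d i), key]
  simp only [mul_assoc]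

/-! ### Iterated Laurent series and generic sums -/

/-- The field `F((t₁))…((tₙ))` of iterated Laurent series: formal series `∑ c_α t^α`, `α ∈ ℤⁿ`,
whose support is well-ordered for the lexicographic order of `ℤⁿ` from right to left. -/
abbrev IterLaurent (F : Type*) [Field F] (n : ℕ) : Type _ :=
  HahnSeries (Lex ((Fin n)ᵒᵈ → ℤ)) F

/-- The indeterminate `tᵢ` of `F((t₁))…((tₙ))`. -/
def IterLaurent.t (F : Type*) [Field F] (n : ℕ) (i : Fin n) : IterLaurent F n :=
  HahnSeries.single (toLex (Pi.single (OrderDual.toDual i) (1 : ℤ))) (1 : F)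

/-- `Q̂ = Q ⊗ F̂` for the quaternion algebra `Q = (b, c)_F` and `F̂ = F((t₁))…((tₙ))`. -/
abbrev QuatHat {F : Type*} [Field F] (b c : F) (n : ℕ) : Type _ :=
  ℍ[IterLaurent F n, (HahnSeries.C b : IterLaurent F n), (HahnSeries.C c : IterLaurent F n)]

/-- The inclusion of `Q` in `Q̂`. -/
def toQuatHat {F : Type*} [Field F] {b c : F} (n : ℕ) : ℍ[F, b, c] →ₐ[F] QuatHat b c n where
  toFun q := ⟨HahnSeries.C q.re, HahnSeries.C q.imI, HahnSeries.C q.imJ, HahnSeries.C q.imK⟩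
  map_one' := by ext <;> simp
  map_mul' x y := by ext <;> simp
  map_zero' := by ext <;> simp
  map_add' x y := by ext <;> simp
  commutes' r := by
    ext <;> simp [Algebra.algebraMap_eq_smul_one, HahnSeries.coeff_single, HahnSeries.coeff_one]

/-- The canonical map from `F̂ ⊗ Q` to `Q̂` is an isomorphism. -/
theorem bijective_lift_toQuatHat {F : Type*} [Field F] (b c : F) (n : ℕ) :
    Function.Bijective (Algebra.TensorProduct.lift
      (Algebra.ofId (IterLaurent F n) (QuatHat b c n)) (toQuatHat (b := b) (c := c) n)
      (fun x _ => Algebra.commutes x _)) := by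
  let B := (QuaternionAlgebra.basisOneIJK b 0 c).baseChange (IterLaurent F n)
  let B' := QuaternionAlgebra.basisOneIJK
    (HahnSeries.C b : IterLaurent F n) 0 (HahnSeries.C c : IterLaurent F n)
  have h : (Algebra.TensorProduct.lift
      (Algebra.ofId (IterLaurent F n) (QuatHat b c n)) (toQuatHat (b := b) (c := c) n)
      (fun x _ => Algebra.commutes x _)).toLinearMap
      = (B.equiv B' (Equiv.refl _)).toLinearMap := by
    apply B.ext
    intro i
    simp only [LinearEquiv.coe_coe, Module.Basis.equiv_apply]
    simp [B]
    apply B'.repr.injective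
    ext j
    simp [B', QuaternionAlgebra.coe_basisOneIJK_repr, Finsupp.single_apply]
    fin_cases i <;> fin_cases j <;> simp [toQuatHat, QuaternionAlgebra.basisOneIJK]
  have := (B.equiv B' (Equiv.refl _)).bijective
  rw [← LinearEquiv.coe_coe, ← h] at this
  exact this

/-- The involution on `Mₙ(Q̂)` adjoint to the generic skew-hermitian form `⟨t₁q₁, …, tₙqₙ⟩`. -/
def genericInvolution {F : Type*} [Field F] {b c : F} {n : ℕ} (q : Fin n → ℍ[F, b, c]) :
    Matrix (Fin n) (Fin n) (QuatHat b c n) → Matrix (Fin n) (Fin n) (QuatHat b c n) :=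
  diagAdjoint fun i => IterLaurent.t F n i • toQuatHat n (q i)

/-- The sequence `q₁, q₂, q₃, q₃, …, q₃` of length `n`. -/
def quatSeq {Q : Type*} (q₁ q₂ q₃ : Q) (n : ℕ) (i : Fin n) : Q :=
  if i.val = 0 then q₁ else if i.val = 1 then q₂ else q₃

/-! ### Quaternion division algebras and the conditions on three pure quaternions -/

/-- The quaternion algebra `(b, c)_F` is a division algebra. -/
def IsQuatDivision {F : Type*} [Field F] (b c : F) : Prop :=
  ∀ x : ℍ[F, b, c], x ≠ 0 → IsUnit x

/-- `q₁`, `q₂`, `q₃` are pure quaternions of `Q = (b, c)_F` with nonzero squares `a₁`, `a₂`, `a₃`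
in `F`, the field `F(√(a₁a₂))` splits `Q`, and neither `F(√(a₁a₃))` nor `F(√(a₂a₃))` does. -/
structure SplitCondition {F : Type*} [Field F] {b c : F} (q₁ q₂ q₃ : ℍ[F, b, c])
    (a₁ a₂ a₃ : F) : Prop where
  pure₁ : q₁.re = 0
  pure₂ : q₂.re = 0
  pure₃ : q₃.re = 0
  ne₁ : a₁ ≠ 0
  ne₂ : a₂ ≠ 0
  ne₃ : a₃ ≠ 0
  sq₁ : q₁ ^ 2 = algebraMap F ℍ[F, b, c] a₁
  sq₂ : q₂ ^ 2 = algebraMap F ℍ[F, b, c] a₂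
  sq₃ : q₃ ^ 2 = algebraMap F ℍ[F, b, c] a₃
  split₁₂ : IsSplitBy F ℍ[F, b, c] (SqrtField F (a₁ * a₂))
  not_split₁₃ : ¬ IsSplitBy F ℍ[F, b, c] (SqrtField F (a₁ * a₃))
  not_split₂₃ : ¬ IsSplitBy F ℍ[F, b, c] (SqrtField F (a₂ * a₃))

/-- The rational function field `k(r, s, t)`. -/
abbrev RatFunc3 (k : Type*) [Field k] : Type _ := FractionRing (MvPolynomial (Fin 3) k)

/-- The `i`-th indeterminate (`r`, `s` or `t`) of `k(r, s, t)`. -/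
def RatFunc3.ind (k : Type*) [Field k] (i : Fin 3) : RatFunc3 k :=
  algebraMap (MvPolynomial (Fin 3) k) (RatFunc3 k) (MvPolynomial.X i)

end

/-! Part 1. Write `H = diag(tᵢqᵢ)`; a similitude `g` with multiplier `μ` satisfies `gᴴHg = μH`. The
substitution `θ : t^γ ↦ t^(2γ)` turns every `tᵢ` into a square. With `eᵢ` the exponent of `tᵢ` and
`w` the order of `μ`, the matrix `G` with entries `t^(eᵢ - eⱼ - w) θ(gᵢⱼ)` is a similitude of the
constant form `⟨q₁, …, qₙ⟩`, whose multiplier has order `0`. The entry `Gᵢⱼ` is supported in the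
coset `eᵢ - eⱼ - w + 2Γ`, and the `eᵢ` are independent modulo `2Γ`. So lowest terms in a column
cannot cancel, since `z̄qz ≠ 0` for nonzero `q, z` in the division algebra `Q`. Hence `G` is
integral; as `n ≥ 3`, its residue is diagonal, with entries `uⱼ` satisfying `ūⱼqⱼuⱼ = μ₀qⱼ`
(`residue_of_similitude`).

Each `uⱼ` either commutes with `qⱼ`, with norm `μ₀`, or anticommutes with it, with norm `-μ₀`
(`commute_or_anticommute`). If `uⱼ` commutes and `uₖ` anticommutes, then `μ₀` is a norm from
`F(√aⱼ)` and `Q = (aₖ, μ₀)`, so `F(√(aⱼaₖ))` splits `Q` (`isIsotropic_of_anticommute`). The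
hypotheses exclude this whenever `j` or `k` is the third index, so all the signs agree with the
third. As `n` is even, the product of the norms is `μ₀^n`, whereas an improper `g` would give
`-μ₀^n`.

Part 2. If `σ(s) = -s` then `Hs` is hermitian, and the reduced norm of a hermitian matrix is a
square (`exists_detRep_eq_sq`). So `Nrd s` lies in the class of `Nrd H`, which is that of `a₁a₂`. If
this were a square in `F̂`, leading coefficients would make it a square in `F`, and `Q` would be
split. Otherwise `F(√(a₁a₂))` embeds in `Z`, which therefore splits `Q̂`.

Example. For a suitable variable `x`, `aa₃ = a(ax² + e)` with `e` free of `x`. The quadric `m² =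
a(ax² + e)` has a rational parametrization, giving an endomorphism of `k(r,s,t)` over `k` that maps
`aa₃` to a square. Since `Q` comes from `k` and stays division over `k(r,s,t)`, it is not split by
the root of `aa₃`. -/

noncomputable section

/-! ### Norm forms of quaternion algebras, and splitting as isotropy of the norm form. -/

namespace QuaternionAlgebra

section Nrd
variable {R S : Type*} [CommRing R] [CommRing S] {b c : R} {b' c' : S}

/-- The reduced norm of a quaternion. -/
def nrd (x : ℍ[R,b,c]) : R :=
  x.re ^ 2 - b * x.imI ^ 2 - c * x.imJ ^ 2 + b * c * x.imK ^ 2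

theorem nrd_mul (x y : ℍ[R,b,c]) : nrd (x * y) = nrd x * nrd y := by
  simp [nrd]; ring

@[simp] theorem nrd_zero : nrd (0 : ℍ[R,b,c]) = 0 := by simp [nrd]

@[simp] theorem nrd_one : nrd (1 : ℍ[R,b,c]) = 1 := by simp [nrd]

theorem nrd_smul (r : R) (x : ℍ[R,b,c]) : nrd (r • x) = r ^ 2 * nrd x := by
  simp [nrd]; ring

theorem nrd_star (x : ℍ[R,b,c]) : nrd (star x) = nrd x := by simp [nrd]

theorem star_mul_self_eq_nrd (x : ℍ[R,b,c]) : star x * x = algebraMap R _ (nrd x) := by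
  rw [star_mul_eq_coe, coe_algebraMap]
  congr 1
  simp [nrd]; ring

theorem mul_star_self_eq_nrd (x : ℍ[R,b,c]) : x * star x = algebraMap R _ (nrd x) := by
  rw [mul_star_eq_coe, coe_algebraMap]
  congr 1
  simp [nrd]; ring

theorem sq_eq_of_re_eq_zero {x : ℍ[R,b,c]} (hx : x.re = 0) :
    x ^ 2 = algebraMap R _ (-nrd x) := by
  ext <;> simp [nrd, pow_two, hx] <;> ring

theorem nrd_eq_neg_of_sq_eq {x : ℍ[R,b,c]} {a : R} (hx : x.re = 0)
    (h : x ^ 2 = algebraMap R _ a) : nrd x = -a := by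
  rw [sq_eq_of_re_eq_zero hx] at h
  rw [← algebraMap_injective h, neg_neg]

/-- Functoriality of quaternion algebras in the base ring. -/
def mapHom (f : R →+* S) (hb : f b = b') (hc : f c = c') : ℍ[R,b,c] →+* ℍ[S,b',c'] where
  toFun q := ⟨f q.re, f q.imI, f q.imJ, f q.imK⟩
  map_one' := by ext <;> simp
  map_mul' x y := by ext <;> simp [hb, hc]
  map_zero' := by ext <;> simp
  map_add' x y := by ext <;> simp

section
variable (f : R →+* S) (hb : f b = b') (hc : f c = c') (x : ℍ[R,b,c])
@[simp] theorem re_mapHom : (mapHom f hb hc x).re = f x.re := rfl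
@[simp] theorem imI_mapHom : (mapHom f hb hc x).imI = f x.imI := rfl
@[simp] theorem imJ_mapHom : (mapHom f hb hc x).imJ = f x.imJ := rfl
@[simp] theorem imK_mapHom : (mapHom f hb hc x).imK = f x.imK := rfl

theorem nrd_mapHom : nrd (mapHom f hb hc x) = f (nrd x) := by
  simp [nrd, hb, hc]

theorem mapHom_algebraMap (r : R) :
    mapHom f hb hc (algebraMap R _ r) = algebraMap S _ (f r) := by
  ext <;> simp

theorem star_mapHom : star (mapHom f hb hc x) = mapHom f hb hc (star x) := by
  ext <;> simp

theorem mapHom_injective (hf : Function.Injective f) :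
    Function.Injective (mapHom f hb hc) := by
  intro x y h
  simp only [QuaternionAlgebra.ext_iff, re_mapHom, imI_mapHom, imJ_mapHom, imK_mapHom,
    hf.eq_iff] at h
  exact QuaternionAlgebra.ext h.1 h.2.1 h.2.2.1 h.2.2.2
end

end Nrd

/-- The norm form of the quaternion algebra `(b, c)` has a nontrivial zero. -/
def IsIsotropic {R : Type*} [CommRing R] (b c : R) : Prop :=
  ∃ x : ℍ[R,b,c], x ≠ 0 ∧ nrd x = 0

theorem IsIsotropic.map {R S : Type*} [CommRing R] [CommRing S] {b c : R} (h : IsIsotropic b c)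
    (f : R →+* S) (hf : Function.Injective f) : IsIsotropic (f b) (f c) := by
  obtain ⟨x, hx, hx0⟩ := h
  exact ⟨mapHom f rfl rfl x, (map_ne_zero_iff _ (mapHom_injective f rfl rfl hf)).2 hx,
    by rw [nrd_mapHom, hx0, map_zero]⟩

section BaseChange
variable {F : Type*} [Field F] (b c : F) (L : Type*) [Field L] [Algebra F L]

/-- The canonical map to the quaternion algebra over an extension. -/
def toExtension : ℍ[F,b,c] →ₐ[F] ℍ[L,algebraMap F L b,algebraMap F L c] :=
  { mapHom (algebraMap F L) rfl rfl with
    commutes' := fun r => by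
      ext <;> simp [Algebra.algebraMap_eq_smul_one] }

theorem toExtension_apply (x : ℍ[F,b,c]) :
    toExtension b c L x = mapHom (algebraMap F L) rfl rfl x := rfl

theorem commute_ofId_toExtension (x : L) (y : ℍ[F,b,c]) :
    Commute (Algebra.ofId L ℍ[L,algebraMap F L b,algebraMap F L c] x) (toExtension b c L y) :=
  Algebra.commute_algebraMap_left x _

/-- The canonical map from the scalar extension of a quaternion algebra. -/
def baseChangeHom : L ⊗[F] ℍ[F,b,c] →ₐ[L] ℍ[L,algebraMap F L b,algebraMap F L c] :=
  Algebra.TensorProduct.lift (Algebra.ofId L _) (toExtension b c L)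
    (commute_ofId_toExtension b c L)

theorem baseChangeHom_one_tmul (x : ℍ[F,b,c]) :
    baseChangeHom b c L (1 ⊗ₜ x) = toExtension b c L x := by
  rw [baseChangeHom, Algebra.TensorProduct.lift_tmul, map_one, one_mul]

theorem baseChangeHom_bijective : Function.Bijective (baseChangeHom b c L) := by
  let B := (QuaternionAlgebra.basisOneIJK b 0 c).baseChange L
  let B' := QuaternionAlgebra.basisOneIJK (algebraMap F L b) 0 (algebraMap F L c)
  have h : (baseChangeHom b c L).toLinearMap = (B.equiv B' (Equiv.refl _)).toLinearMap := by
    apply B.ext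
    intro i
    simp only [LinearEquiv.coe_coe, Module.Basis.equiv_apply]
    rw [AlgHom.toLinearMap_apply, Module.Basis.baseChange_apply, baseChangeHom_one_tmul]
    apply B'.repr.injective
    ext j
    simp [B', QuaternionAlgebra.coe_basisOneIJK_repr, Finsupp.single_apply]
    fin_cases i <;> fin_cases j <;> simp [toExtension_apply, QuaternionAlgebra.basisOneIJK]
  have := (B.equiv B' (Equiv.refl _)).bijective
  rw [← LinearEquiv.coe_coe, ← h] at this
  exact this

/-- Quaternion algebras commute with scalar extension. -/
def baseChangeEquiv : L ⊗[F] ℍ[F,b,c] ≃ₐ[L] ℍ[L,algebraMap F L b,algebraMap F L c] :=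
  AlgEquiv.ofBijective _ (baseChangeHom_bijective b c L)

end BaseChange

section Field
variable {F : Type*} [Field F] {b c : F}

theorem isUnit_of_nrd_ne_zero {x : ℍ[F,b,c]} (h : nrd x ≠ 0) : IsUnit x := by
  refine isUnit_iff_exists.2 ⟨(nrd x)⁻¹ • star x, ?_, ?_⟩
  · rw [mul_smul_comm, mul_star_self_eq_nrd, Algebra.smul_def, ← map_mul, inv_mul_cancel₀ h,
      map_one]
  · rw [smul_mul_assoc, star_mul_self_eq_nrd, Algebra.smul_def, ← map_mul, inv_mul_cancel₀ h,
      map_one]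

theorem nrd_ne_zero_of_isUnit {x : ℍ[F,b,c]} (h : IsUnit x) : nrd x ≠ 0 := by
  obtain ⟨y, hy, -⟩ := isUnit_iff_exists.1 h
  intro h0
  have := nrd_mul x y
  rw [hy, h0, zero_mul, nrd_one] at this
  exact one_ne_zero this

theorem isQuatDivision_iff : IsQuatDivision b c ↔ ¬ IsIsotropic b c := by
  constructor
  · rintro h ⟨x, hx, hx0⟩
    exact nrd_ne_zero_of_isUnit (h x hx) hx0
  · intro h x hx
    exact isUnit_of_nrd_ne_zero fun h0 => h ⟨x, hx, h0⟩

/-- With `N` the norm form of `F[√b]`, the quaternion norm is `N(x₀, x₁) - c N(x₂, x₃)`. A zero with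
`N(x₂, x₃) ≠ 0` exhibits `c` as a quotient of norms, hence as a norm. Otherwise `N` is isotropic, so
`b` is a square and `N` represents everything. -/
theorem exists_eq_sq_sub_of_isIsotropic (h2 : (2 : F) ≠ 0) (hb : b ≠ 0)
    (h : IsIsotropic b c) : ∃ x y : F, c = x ^ 2 - b * y ^ 2 := by
  have key : ∀ y : F, b = y ^ 2 → ∃ x y : F, c = x ^ 2 - b * y ^ 2 := by
    intro y hy
    have hy0 : y ≠ 0 := by rintro rfl; simp at hy; exact hb hy
    refine ⟨(c + 1) / 2, (c - 1) / (2 * y), ?_⟩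
    rw [hy]; field_simp; ring
  obtain ⟨⟨x0, x1, x2, x3⟩, hx, h0⟩ := h
  simp only [nrd] at h0
  have key2 : ∀ p q : F, p ^ 2 - b * q ^ 2 = 0 → (p ≠ 0 ∨ q ≠ 0) →
      ∃ x y : F, c = x ^ 2 - b * y ^ 2 := by
    intro p q h hpq
    have hq : q ≠ 0 := by
      rintro rfl
      simp at h
      simp [h] at hpq
    refine key (p / q) ?_
    field_simp
    linear_combination -h
  by_cases h23 : x2 ^ 2 - b * x3 ^ 2 = 0
  · by_cases hz : x2 = 0 ∧ x3 = 0
    · obtain ⟨rfl, rfl⟩ := hz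
      refine key2 x0 x1 (by linear_combination h0) ?_
      by_contra! hcon
      exact hx (by ext <;> simp [hcon])
    · exact key2 x2 x3 h23 (by tauto)
  -- The coordinates of `(x₀ + x₁√b)(x₂ + x₃√b) / N(x₂, x₃)`.
  · refine ⟨(x0 * x2 + b * x1 * x3) / (x2 ^ 2 - b * x3 ^ 2),
      (x0 * x3 + x1 * x2) / (x2 ^ 2 - b * x3 ^ 2), ?_⟩
    field_simp
    linear_combination (-(x2 ^ 2 - b * x3 ^ 2)) * h0

/-- The representation of the quaternion algebra `(b, x² - b y²)` by `2 × 2` matrices. -/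
def matrixBasis (b x y : F) :
    QuaternionAlgebra.Basis (Matrix (Fin 2) (Fin 2) F) b 0 (x ^ 2 - b * y ^ 2) where
  -- On `F[√b]` with basis `1, √b`, the element `i` is multiplication by `√b`, and `j` is
  -- conjugation followed by multiplication by `x + y√b`.
  i := !![0, b; 1, 0]
  j := !![x, -b * y; y, -x]
  k := !![b * y, -b * x; x, -b * y]
  i_mul_i := by ext i j; fin_cases i <;> fin_cases j <;> simp
  j_mul_j := by ext i j; fin_cases i <;> fin_cases j <;> simp <;> ring
  i_mul_j := by ext i j; fin_cases i <;> fin_cases j <;> simp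
  j_mul_i := by ext i j; fin_cases i <;> fin_cases j <;> simp <;> ring

theorem nonempty_algEquiv_matrix (h2 : (2 : F) ≠ 0) (hb : b ≠ 0) (hc : c ≠ 0)
    (h : IsIsotropic b c) : Nonempty (ℍ[F,b,c] ≃ₐ[F] Matrix (Fin 2) (Fin 2) F) := by
  obtain ⟨x, y, rfl⟩ := exists_eq_sq_sub_of_isIsotropic h2 hb h
  have hinj : Function.Injective (matrixBasis b x y).liftHom := by
    rw [injective_iff_map_eq_zero]
    rintro ⟨p, q, r, s⟩ h
    have h00 := congr_fun (congr_fun h 0) 0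
    have h01 := congr_fun (congr_fun h 0) 1
    have h10 := congr_fun (congr_fun h 1) 0
    have h11 := congr_fun (congr_fun h 1) 1
    simp [Basis.lift, matrixBasis, Algebra.algebraMap_eq_smul_one] at h00 h01 h10 h11
    have hp : p = 0 :=
      (mul_eq_zero.1 (show 2 * p = 0 by linear_combination h00 + h11)).resolve_left h2
    have hq : q = 0 := by
      refine (mul_eq_zero.1 (show (2 * b) * q = 0 by linear_combination h01 + b * h10)).resolve_left
        (mul_ne_zero h2 hb)
    subst hp hq
    have hr : r = 0 := by
      refine (mul_eq_zero.1 (show (x ^ 2 - b * y ^ 2) * r = 0 by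
        linear_combination x * h00 - b * y * h10)).resolve_left hc
    have hs : s = 0 := by
      refine (mul_eq_zero.1 (show (x ^ 2 - b * y ^ 2) * s = 0 by
        linear_combination x * h10 - y * h00)).resolve_left hc
    subst hr hs
    rfl
  refine ⟨AlgEquiv.ofBijective _ ⟨hinj, ?_⟩⟩
  exact (LinearMap.injective_iff_surjective_of_finrank_eq_finrank
    (f := (matrixBasis b x y).liftHom.toLinearMap)
    (by rw [finrank_eq_four, Module.finrank_matrix]; simp)).1 hinj

/-- A dimension count gives `d = 2`, and an off-diagonal matrix unit is a nonzero element of square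
zero, hence of norm zero. -/
theorem isIsotropic_of_algEquiv {d : ℕ} (e : ℍ[F,b,c] ≃ₐ[F] Matrix (Fin d) (Fin d) F) :
    IsIsotropic b c := by
  have hd : d = 2 := by
    have := e.toLinearEquiv.finrank_eq
    rw [finrank_eq_four, Module.finrank_matrix] at this
    simp at this
    nlinarith
  subst hd
  set x := e.symm (Matrix.single 0 1 1) with hx
  have hxx : x * x = 0 := by
    rw [hx, ← map_mul]; simp
  refine ⟨x, ?_, ?_⟩
  · rw [hx, Ne, map_eq_zero_iff _ e.symm.injective]
    intro h
    have := congr_fun (congr_fun h 0) 1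
    simp at this
  · have := nrd_mul x x
    rw [hxx, nrd_zero] at this
    simpa using this.symm

theorem isSplitBy_iff (h2 : (2 : F) ≠ 0) (hb : b ≠ 0) (hc : c ≠ 0)
    (L : Type*) [Field L] [Algebra F L] :
    IsSplitBy F ℍ[F,b,c] L ↔ IsIsotropic (algebraMap F L b) (algebraMap F L c) := by
  constructor
  · rintro ⟨d, ⟨e⟩⟩
    exact isIsotropic_of_algEquiv ((baseChangeEquiv b c L).symm.trans e)
  · intro h
    have h2' : (2 : L) ≠ 0 := by
      rw [← map_ofNat (algebraMap F L) 2]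
      exact (map_ne_zero (algebraMap F L)).2 h2
    obtain ⟨e⟩ := nonempty_algEquiv_matrix h2' (by simpa) (by simpa) h
    exact ⟨2, ⟨(baseChangeEquiv b c L).trans e⟩⟩

end Field

end QuaternionAlgebra

/-! ### Quadratic extensions as splitting fields. -/

section SqrtField
variable {F : Type*} [Field F] (d : F)

theorem SqrtField.exists_sq : ∃ w : SqrtField F d, w ^ 2 = algebraMap F _ d := by
  have h := Polynomial.SplittingField.splits (Polynomial.X ^ 2 - Polynomial.C d : Polynomial F)
  obtain ⟨w, hw⟩ := h.exists_eval_eq_zero (by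
    rw [Polynomial.degree_map, Polynomial.degree_X_pow_sub_C (by norm_num)]; norm_num)
  refine ⟨w, ?_⟩
  simpa [sub_eq_zero] using hw

variable {d} in
theorem SqrtField.exists_algHom {M : Type*} [Field M] [Algebra F M] {m : M}
    (hm : m ^ 2 = algebraMap F M d) : Nonempty (SqrtField F d →ₐ[F] M) := by
  refine ⟨Polynomial.SplittingField.lift _ ?_⟩
  have : (Polynomial.X ^ 2 - Polynomial.C d : Polynomial F).map (algebraMap F M)
      = (Polynomial.X - Polynomial.C m) * (Polynomial.X + Polynomial.C m) := by
    simp [← hm]; ring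
  rw [this]
  exact (Polynomial.Splits.X_sub_C m).mul (Polynomial.Splits.X_add_C m)

open QuaternionAlgebra in
-- The map `f` is an arbitrary field embedding: below it is also taken to be an endomorphism of
-- `k(r,s,t)` and the inclusion of `F` in `Z`.
theorem isIsotropic_of_isSplitBy_sqrtField (h2 : (2 : F) ≠ 0) {b c : F} (hb : b ≠ 0) (hc : c ≠ 0)
    {d : F} (h : IsSplitBy F ℍ[F,b,c] (SqrtField F d)) {M : Type*} [Field M] (f : F →+* M)
    {m : M} (hm : m ^ 2 = f d) : IsIsotropic (f b) (f c) := by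
  let _ := f.toAlgebra
  obtain ⟨g⟩ := SqrtField.exists_algHom (F := F) (M := M) hm
  have := ((isSplitBy_iff h2 hb hc _).1 h).map g.toRingHom g.toRingHom.injective
  simpa [RingHom.algebraMap_toAlgebra] using this

end SqrtField
end

/-! ### Similitudes of skew-hermitian forms of rank one. -/

noncomputable section

namespace QuaternionAlgebra
variable {F : Type*} [Field F] {b c : F}

/-- Taking norms gives `nrd u ^ 2 = μ ^ 2`; multiplying the hypothesis on the left by `u` gives `nrd
u • qu = μ • uq`, so the sign of `nrd u / μ` decides between the two cases. -/
theorem commute_or_anticommute {q u : ℍ[F,b,c]} {a μ : F} (ha : a ≠ 0) (hq : q.re = 0)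
    (hqa : q ^ 2 = algebraMap F _ a) (hμ : μ ≠ 0)
    (h : star u * q * u = algebraMap F _ μ * q) :
    (nrd u = μ ∧ u * q = q * u) ∨ (nrd u = -μ ∧ q * u = -(u * q)) := by
  have hnq : nrd q ≠ 0 := by rw [nrd_eq_neg_of_sq_eq hq hqa]; simpa
  have h1 : nrd u ^ 2 = μ ^ 2 := by
    have := congr_arg nrd h
    rw [← Algebra.smul_def, nrd_smul, nrd_mul, nrd_mul, nrd_star] at this
    refine mul_right_cancel₀ hnq ?_
    rw [← this]; ring
  have h2 : algebraMap F _ (nrd u) * (q * u) = algebraMap F _ μ * (u * q) := by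
    rw [← mul_star_self_eq_nrd, mul_assoc, ← mul_assoc (star u), h, Algebra.left_comm]
  have hcancel : ∀ x y : ℍ[F,b,c], algebraMap F _ μ * x = algebraMap F _ μ * y → x = y := by
    intro x y hxy
    rw [← Algebra.smul_def, ← Algebra.smul_def] at hxy
    exact smul_right_injective _ hμ hxy
  rcases sq_eq_sq_iff_eq_or_eq_neg.1 h1 with h3 | h3
  · refine Or.inl ⟨h3, (hcancel _ _ ?_).symm⟩
    rw [← h2, h3]
  · refine Or.inr ⟨h3, hcancel _ _ ?_⟩
    rw [h3, map_neg, neg_mul] at h2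
    rw [mul_neg, ← h2, neg_neg]

/-- The centralizer of `q` is `F[q]`, so `u = x + yq`. -/
theorem nrd_eq_of_commute (h2 : (2 : F) ≠ 0) {q u : ℍ[F,b,c]} {a : F} (ha : a ≠ 0)
    (hq : q.re = 0) (hqa : q ^ 2 = algebraMap F _ a) (h : u * q = q * u) :
    ∃ x y : F, nrd u = x ^ 2 - a * y ^ 2 := by
  obtain ⟨u0, u1, u2, u3⟩ := u
  obtain ⟨q0, q1, q2, q3⟩ := q
  simp only at hq
  subst hq
  have hna := nrd_eq_neg_of_sq_eq rfl hqa
  simp only [nrd] at hna ⊢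
  simp only [QuaternionAlgebra.ext_iff, re_mul, imI_mul, imJ_mul, imK_mul] at h
  obtain ⟨-, h1, h2', h3⟩ := h
  have e1 : c * (u2 * q3 - u3 * q2) = 0 := by
    refine (mul_eq_zero.1 (?_ : (2 : F) * _ = 0)).resolve_left h2
    linear_combination -h1
  have e2 : b * (u1 * q3 - u3 * q1) = 0 := by
    refine (mul_eq_zero.1 (?_ : (2 : F) * _ = 0)).resolve_left h2
    linear_combination h2'
  have e3 : u1 * q2 - u2 * q1 = 0 := by
    refine (mul_eq_zero.1 (?_ : (2 : F) * _ = 0)).resolve_left h2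
    linear_combination h3
  -- If `u = x + yq`, then `x` is the scalar part of `u` and `ya` is that of `uq`.
  refine ⟨u0, (b * u1 * q1 + c * u2 * q2 - b * c * u3 * q3) / a, ?_⟩
  field_simp
  have hna' : a = b * q1 ^ 2 + c * q2 ^ 2 - b * c * q3 ^ 2 := by linear_combination hna
  rw [hna']
  linear_combination (-(b * c) * (u1 * q2 - u2 * q1)) * e3
    + b * c * (u1 * q3 - u3 * q1) * e2 + b * c * (u2 * q3 - u3 * q2) * e1

theorem re_eq_zero_of_anticommute (h2 : (2 : F) ≠ 0) {q u : ℍ[F,b,c]} (hq0 : q ≠ 0)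
    (hq : q.re = 0) (h : q * u = -(u * q)) : u.re = 0 := by
  by_contra hu
  refine hq0 ?_
  simp only [QuaternionAlgebra.ext_iff, re_mul, imI_mul, imJ_mul, imK_mul, imI_neg, imJ_neg,
    imK_neg, hq] at h
  obtain ⟨-, h1, h2', h3⟩ := h
  have hu2 := mul_ne_zero h2 hu
  ext
  · exact hq
  · exact (mul_eq_zero.1 (show (2 * u.re) * q.imI = 0 by linear_combination h1)).resolve_left hu2
  · exact (mul_eq_zero.1 (show (2 * u.re) * q.imJ = 0 by linear_combination h2')).resolve_left hu2
  · exact (mul_eq_zero.1 (show (2 * u.re) * q.imK = 0 by linear_combination h3)).resolve_left hu2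

theorem re_mul_comm (x y : ℍ[F,b,c]) : (x * y).re = (y * x).re := by
  simp; ring

theorem nrd_eq_sq_add {x : ℍ[F,b,c]} (r : F) (hx : x.re = 0) :
    nrd (algebraMap F _ r + x) = r ^ 2 + nrd x := by
  simp [nrd, hx, QuaternionAlgebra.algebraMap_eq]; ring

/-- Over `M` the element `m / a · q` is a square root of `a'`, so `μ = x² - a'y²` becomes the norm
of some `z` in `M[q]`. As `u` and `qu` are pure, so is `zu`, and `nrd (zu) = -μ²`; hence `μ + zu`
has norm `0` and nonzero scalar part. -/
theorem isIsotropic_of_anticommute (h2 : (2 : F) ≠ 0) {q u : ℍ[F,b,c]} {a a' μ x y : F}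
    (ha : a ≠ 0) (hq : q.re = 0) (hqa : q ^ 2 = algebraMap F _ a) (hμ : μ ≠ 0)
    (hu : nrd u = -μ) (hqu : q * u = -(u * q)) (hxy : μ = x ^ 2 - a' * y ^ 2)
    {M : Type*} [Field M] (f : F →+* M) {m : M} (hm : m ^ 2 = f (a * a')) :
    IsIsotropic (f b) (f c) := by
  have hq0 : q ≠ 0 := by
    rintro rfl
    have := nrd_eq_neg_of_sq_eq rfl hqa
    simp at this
    exact ha this
  have hur := re_eq_zero_of_anticommute h2 hq0 hq hqu
  have hqur : (q * u).re = 0 := by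
    have h1 := congr_arg QuaternionAlgebra.re hqu
    rw [re_neg, re_mul_comm u] at h1
    exact (mul_eq_zero.1 (show 2 * (q * u).re = 0 by linear_combination h1)).resolve_left h2
  have hfa : f a ≠ 0 := (map_ne_zero f).2 ha
  let φ : ℍ[F,b,c] →+* ℍ[M,f b,f c] := mapHom f rfl rfl
  let z : ℍ[M,f b,f c] := algebraMap M _ (f x) + (f y * m / f a) • φ q
  have hz : nrd z = f μ := by
    rw [nrd_eq_sq_add _ (by simp [φ, hq]), nrd_smul, nrd_mapHom, nrd_eq_neg_of_sq_eq hq hqa, hxy]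
    rw [map_sub, map_mul, map_pow, map_pow, map_neg, div_pow, mul_pow, hm, map_mul]
    field_simp
    ring
  have hre : (z * φ u).re = 0 := by
    rw [add_mul, re_add, smul_mul_assoc, ← map_mul, re_smul, re_mapHom, hqur,
      ← Algebra.smul_def, re_smul, re_mapHom, hur]
    simp
  refine ⟨algebraMap M _ (f μ) + z * φ u, ?_, ?_⟩
  · intro h
    have := congr_arg QuaternionAlgebra.re h
    rw [re_add, hre] at this
    simp [hμ] at this
  · rw [nrd_eq_sq_add _ hre, nrd_mul, hz, nrd_mapHom, hu, map_neg]
    ring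

end QuaternionAlgebra
end

noncomputable section

/-! ### Reduced norms -/

section DetRep
variable {F : Type*} [Field F] {A : Type*} [Ring A] [Algebra F A]

/-- Scalar extension of matrix algebras. -/
def tensorMatrixEquiv (L K : Type*) [Field L] [Field K] [Algebra L K] (ι : Type*) [Fintype ι]
    [DecidableEq ι] : K ⊗[L] Matrix ι ι L ≃ₐ[K] Matrix ι ι K :=
  AlgEquiv.ofRingEquiv (f := (matrixEquivTensor ι L K).symm.toRingEquiv) (by
    intro r
    change (matrixEquivTensor ι L K).symm (r ⊗ₜ 1) = _
    rw [matrixEquivTensor_apply_symm, Matrix.map_one _ (map_zero _) (map_one _),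
      Algebra.algebraMap_eq_smul_one])

theorem tensorMatrixEquiv_tmul {L K : Type*} [Field L] [Field K] [Algebra L K] {ι : Type*}
    [Fintype ι] [DecidableEq ι] (x : Matrix ι ι L) :
    tensorMatrixEquiv L K ι (1 ⊗ₜ x) = x.map (algebraMap L K) := by
  change (matrixEquivTensor ι L K).symm (1 ⊗ₜ x) = _
  rw [matrixEquivTensor_apply_symm, one_smul]

/-- Transitivity of scalar extension for noncommutative algebras. -/
def tensorTensorEquiv (F L K A : Type*) [Field F] [Field L] [Field K] [Ring A] [Algebra F A]
    [Algebra F L] [Algebra F K] [Algebra L K] [IsScalarTower F L K] :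
    K ⊗[F] A ≃ₐ[K] K ⊗[L] (L ⊗[F] A) :=
  Algebra.TensorProduct.algEquivOfLinearEquivTensorProduct
    (TensorProduct.AlgebraTensorModule.cancelBaseChange F L K K A).symm
    (by intro x y a a'; simp) (by simp [Algebra.TensorProduct.one_def])

theorem tensorTensorEquiv_tmul {F L K A : Type*} [Field F] [Field L] [Field K] [Ring A]
    [Algebra F A] [Algebra F L] [Algebra F K] [Algebra L K] [IsScalarTower F L K] (a : A) :
    tensorTensorEquiv F L K A (1 ⊗ₜ a) = 1 ⊗ₜ (1 ⊗ₜ a) :=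
  TensorProduct.AlgebraTensorModule.cancelBaseChange_symm_tmul F L K 1 a

/-- The determinants of two matrix representations of the same degree agree. -/
theorem det_eq_of_algEquiv {L K : Type*} [Field L] [Field K] [Algebra F L] [Algebra F K]
    [Algebra L K] [IsScalarTower F L K] {ι κ : Type*} [Fintype ι] [DecidableEq ι] [Fintype κ]
    [DecidableEq κ] [Nonempty κ] [FiniteDimensional F A]
    (hA : Module.finrank F A = Fintype.card κ * Fintype.card κ)
    (φ : L ⊗[F] A ≃ₐ[L] Matrix ι ι L) (ψ : A →ₐ[F] Matrix κ κ K) (a : A) :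
    (ψ a).det = algebraMap L K (φ (1 ⊗ₜ a)).det := by
  let Φ : K ⊗[F] A ≃ₐ[K] Matrix ι ι K :=
    ((tensorTensorEquiv F L K A).trans
      (Algebra.TensorProduct.congr AlgEquiv.refl φ)).trans (tensorMatrixEquiv L K ι)
  have hΦ : Φ (1 ⊗ₜ a) = (φ (1 ⊗ₜ a)).map (algebraMap L K) := by
    simp only [Φ, AlgEquiv.trans_apply, tensorTensorEquiv_tmul,
      Algebra.TensorProduct.congr_apply, Algebra.TensorProduct.map_tmul]
    exact tensorMatrixEquiv_tmul _
  let Ψ : K ⊗[F] A →ₐ[K] Matrix κ κ K :=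
    Algebra.TensorProduct.lift (Algebra.ofId K _) ψ (fun x y => Algebra.commute_algebraMap_left x _)
  have hΨ : Ψ (1 ⊗ₜ a) = ψ a := by
    refine (Algebra.TensorProduct.lift_tmul _ _ _ _ _).trans ?_
    rw [map_one, one_mul]
  let e : Matrix ι ι K →ₐ[K] Matrix κ κ K := Ψ.comp Φ.symm.toAlgHom
  have hdim : Module.finrank K (Matrix ι ι K) = Module.finrank K (Matrix κ κ K) := by
    rw [← Φ.toLinearEquiv.finrank_eq, Module.finrank_baseChange, hA, Module.finrank_matrix]
    simp
  -- Nonemptiness makes the matrix algebra over `K` a simple ring, so `e` is injective.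
  have hι : Nonempty ι := by
    by_contra hι
    rw [not_nonempty_iff] at hι
    rw [Module.finrank_matrix, Module.finrank_matrix] at hdim
    simp at hdim
  have hinj : Function.Injective e := e.toRingHom.injective
  have hbij : Function.Bijective e := ⟨hinj,
    (LinearMap.injective_iff_surjective_of_finrank_eq_finrank (f := e.toLinearMap) hdim).1 hinj⟩
  have h1 : AlgEquiv.ofBijective e hbij (Φ (1 ⊗ₜ a)) = ψ a := by
    rw [← hΨ]
    change Ψ (Φ.symm (Φ (1 ⊗ₜ a))) = _
    rw [Φ.symm_apply_apply]
  -- An isomorphism between matrix algebras over a field preserves determinants.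
  rw [← h1, Matrix.det_map, hΦ]
  exact (RingHom.map_det _ _).symm

/-- Two extensions of a field have a common extension. -/
theorem exists_common_extension (F : Type*) [Field F] (L : Type u) (M : Type v) [Field L]
    [Field M] [Algebra F L] [Algebra F M] :
    ∃ (K : Type (max u v)) (_ : Field K) (i : L →+* K) (j : M →+* K),
      i.comp (algebraMap F L) = j.comp (algebraMap F M) := by
  obtain ⟨m, hm⟩ := Ideal.exists_maximal (L ⊗[F] M)
  refine ⟨(L ⊗[F] M) ⧸ m, Ideal.Quotient.field m,
    (Ideal.Quotient.mk m).comp (Algebra.TensorProduct.includeLeftRingHom),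
    (Ideal.Quotient.mk m).comp (Algebra.TensorProduct.includeRight (R := F)).toRingHom, ?_⟩
  ext r
  simp only [RingHom.comp_apply]
  congr 1
  simp [Algebra.TensorProduct.algebraMap_apply]

end DetRep

namespace QuaternionAlgebra

section Rep
variable {R S T : Type*} [CommRing R] [CommRing S] [CommRing T] {b c : R}

/-- The representation of a quaternion algebra `(b, c)` by `2 × 2` matrices over a ring in
which `b` is a square. -/
def splitRep (c : R) (f : R →+* S) {s : S} (hs : s ^ 2 = f b) :
    ℍ[R,b,c] →+* Matrix (Fin 2) (Fin 2) S where
  toFun x := !![f x.re + s * f x.imI, f c * (f x.imJ + s * f x.imK);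
    f x.imJ - s * f x.imK, f x.re - s * f x.imI]
  map_one' := by ext i j; fin_cases i <;> fin_cases j <;> simp
  map_zero' := by ext i j; fin_cases i <;> fin_cases j <;> simp
  map_add' x y := by ext i j; fin_cases i <;> fin_cases j <;> simp <;> ring
  map_mul' x y := by
    ext i j
    fin_cases i <;> fin_cases j <;> simp [Matrix.mul_apply, ← hs] <;> ring

theorem det_splitRep (f : R →+* S) {s : S} (hs : s ^ 2 = f b) (x : ℍ[R,b,c]) :
    (splitRep c f hs x).det = f (nrd x) := by
  simp [splitRep, Matrix.det_fin_two, nrd, ← hs]; ring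

theorem splitRep_algebraMap (f : R →+* S) {s : S} (hs : s ^ 2 = f b) (r : R) :
    splitRep c f hs (algebraMap R _ r) = algebraMap S _ (f r) := by
  ext i j
  fin_cases i <;> fin_cases j <;> simp [splitRep, Matrix.algebraMap_matrix_apply]

variable {ι : Type*} [Fintype ι] [DecidableEq ι]

/-- The representation of a matrix algebra over a quaternion algebra. -/
def matRep (ι : Type*) [Fintype ι] [DecidableEq ι] (c : R) (f : R →+* S) {s : S}
    (hs : s ^ 2 = f b) : Matrix ι ι ℍ[R,b,c] →+* Matrix (ι × Fin 2) (ι × Fin 2) S :=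
  (Matrix.compRingEquiv ι (Fin 2) S).toRingHom.comp (splitRep c f hs).mapMatrix

theorem matRep_apply (f : R →+* S) {s : S} (hs : s ^ 2 = f b) (g : Matrix ι ι ℍ[R,b,c])
    (i j : ι × Fin 2) : matRep ι c f hs g i j = splitRep c f hs (g i.1 j.1) i.2 j.2 := rfl

/-- The reduced norm of a matrix over a quaternion algebra, computed in a splitting ring. -/
def detRep (f : R →+* S) {s : S} (hs : s ^ 2 = f b) (g : Matrix ι ι ℍ[R,b,c]) : S :=
  (matRep ι c f hs g).det

theorem detRep_mul (f : R →+* S) {s : S} (hs : s ^ 2 = f b) (g h : Matrix ι ι ℍ[R,b,c]) :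
    detRep f hs (g * h) = detRep f hs g * detRep f hs h := by
  rw [detRep, map_mul, Matrix.det_mul]; rfl

theorem detRep_diagonal (f : R →+* S) {s : S} (hs : s ^ 2 = f b) (d : ι → ℍ[R,b,c]) :
    detRep f hs (Matrix.diagonal d) = ∏ i, f (nrd (d i)) := by
  have h : matRep ι c f hs (Matrix.diagonal d)
      = (Matrix.blockDiagonal fun i => splitRep c f hs (d i)).submatrix
        (Equiv.prodComm _ _) (Equiv.prodComm _ _) := by
    ext ⟨i, a⟩ ⟨j, a'⟩
    by_cases hij : i = j
    · subst hij; simp [matRep_apply, Matrix.blockDiagonal_apply]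
    · simp [matRep_apply, Matrix.blockDiagonal_apply, hij]
  rw [detRep, h, Matrix.det_submatrix_equiv_self, Matrix.det_blockDiagonal]
  simp only [det_splitRep]

theorem map_detRep (f : R →+* S) {s : S} (hs : s ^ 2 = f b) (h : S →+* T)
    (hs' : h s ^ 2 = (h.comp f) b) (g : Matrix ι ι ℍ[R,b,c]) :
    h (detRep f hs g) = detRep (h.comp f) hs' g := by
  rw [detRep, RingHom.map_det, detRep]
  congr 1
  ext ⟨i, a⟩ ⟨j, a'⟩
  simp only [RingHom.mapMatrix_apply, Matrix.map_apply, matRep_apply]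
  fin_cases a <;> fin_cases a' <;> simp [splitRep]

theorem detRep_map {b' c' : S} (e : R →+* S) (hb : e b = b') (hc : e c = c') (f : S →+* T) {s : T}
    (hs : s ^ 2 = f b') (hs' : s ^ 2 = (f.comp e) b) (g : Matrix ι ι ℍ[R,b,c]) :
    detRep (c := c') f hs (g.map (mapHom e hb hc)) = detRep (f.comp e) hs' g := by
  rw [detRep, detRep]
  congr 1
  ext ⟨i, a⟩ ⟨j, a'⟩
  simp only [Matrix.map_apply, matRep_apply]
  fin_cases a <;> fin_cases a' <;> simp [splitRep, hc]

end Rep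

section Field
variable {F : Type u} [Field F] {b c : F} {n : ℕ}

/-- `matRep` as a homomorphism of algebras. -/
def matRepAlgHom (ι : Type*) [Fintype ι] [DecidableEq ι] (c : F) {K : Type*} [Field K]
    [Algebra F K] {s : K} (hs : s ^ 2 = algebraMap F K b) :
    Matrix ι ι ℍ[F,b,c] →ₐ[F] Matrix (ι × Fin 2) (ι × Fin 2) K :=
  { matRep ι c (algebraMap F K) hs with
    commutes' := by
      intro r
      change matRep ι c (algebraMap F K) hs _ = _
      ext ⟨i, a⟩ ⟨j, a'⟩
      rw [matRep_apply, Matrix.algebraMap_matrix_apply, Matrix.algebraMap_matrix_apply]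
      by_cases hij : i = j
      · subst hij
        rw [if_pos rfl, splitRep_algebraMap, Matrix.algebraMap_matrix_apply]
        simp
      · simp [hij] }

theorem matRepAlgHom_apply (ι : Type*) [Fintype ι] [DecidableEq ι] (c : F) {K : Type*} [Field K]
    [Algebra F K] {s : K} (hs : s ^ 2 = algebraMap F K b) (g : Matrix ι ι ℍ[F,b,c]) :
    matRepAlgHom ι c hs g = matRep ι c (algebraMap F K) hs g := rfl

theorem finrank_matrix_quaternion (n : ℕ) : Module.finrank F (Matrix (Fin n) (Fin n) ℍ[F,b,c])
    = Fintype.card (Fin n × Fin 2) * Fintype.card (Fin n × Fin 2) := by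
  rw [Module.finrank_matrix, finrank_eq_four]
  simp; ring

/-- The splitting field in `IsReducedNorm` is unspecified; comparison over a common extension with
`M` shows that any field where `b` has a root gives the same value. The embedding `f` is arbitrary
because it is later composed with `t^γ ↦ t^(2γ)`. -/
theorem detRep_eq_of_isReducedNorm [NeZero n] {g : Matrix (Fin n) (Fin n) ℍ[F,b,c]} {r : F}
    (h : IsReducedNorm g r) {M : Type*} [Field M] (f : F →+* M) {s : M} (hs : s ^ 2 = f b) :
    detRep f hs g = f r := by
  obtain ⟨L, _, _, d, φ, hφ⟩ := h
  let _ := f.toAlgebra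
  obtain ⟨K, _, i, j, hij⟩ := exists_common_extension F L M
  let _ : Algebra L K := i.toAlgebra
  let _ : Algebra F K := (i.comp (algebraMap F L)).toAlgebra
  have : IsScalarTower F L K := IsScalarTower.of_algebraMap_eq fun _ => rfl
  have hfK : algebraMap F K = j.comp f := hij
  have hs' : (j s) ^ 2 = algebraMap F K b := by
    rw [hfK, ← map_pow, hs]; rfl
  have h1 := det_eq_of_algEquiv (finrank_matrix_quaternion n) φ (matRepAlgHom (Fin n) c hs') g
  apply j.injective
  rw [map_detRep f hs j (by rw [← hfK, hs'])]
  rw [hφ] at h1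
  calc _ = ((matRepAlgHom (Fin n) c hs') g).det := by
        rw [matRepAlgHom_apply, detRep]
        simp only [hfK]
    _ = _ := h1
    _ = i (algebraMap F L r) := rfl
    _ = j (f r) := RingHom.congr_fun hij r

end Field
end QuaternionAlgebra
end

/-! ### Realizing reduced norms, and determinants of hermitian matrices. -/

noncomputable section

namespace QuaternionAlgebra

section Existence
variable {F : Type u} [Field F] {b c : F} {n : ℕ}

/-- Since `2`, `s` and `c` are invertible in `L`, the images of `1, i, j, ij` span the `2 × 2`
matrices. So the extended representation hits every matrix unit, and equality of dimensions makes it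
an isomorphism. -/
theorem isReducedNorm_of_detRep (h2 : (2 : F) ≠ 0) (hb : b ≠ 0) (hc : c ≠ 0)
    {g : Matrix (Fin n) (Fin n) ℍ[F,b,c]} {r : F} {L : Type u} [Field L] [Algebra F L] {s : L}
    (hs : s ^ 2 = algebraMap F L b)
    (h : detRep (algebraMap F L) hs g = algebraMap F L r) : IsReducedNorm g r := by
  have h2' : (2 : L) ≠ 0 := by
    rw [← map_ofNat (algebraMap F L) 2]
    exact (map_ne_zero (algebraMap F L)).2 h2
  have hs0 : s ≠ 0 := by
    rintro rfl
    have : algebraMap F L b = 0 := by rw [← hs]; simp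
    exact hb ((map_eq_zero _).1 this)
  have hc' : algebraMap F L c ≠ 0 := (map_ne_zero _).2 hc
  let Ψ : L ⊗[F] Matrix (Fin n) (Fin n) ℍ[F,b,c] →ₐ[L]
      Matrix (Fin n × Fin 2) (Fin n × Fin 2) L :=
    Algebra.TensorProduct.lift (Algebra.ofId L _) (matRepAlgHom (Fin n) c hs)
      (fun x y => Algebra.commute_algebraMap_left x _)
  have hΨ : ∀ x a, Ψ (x ⊗ₜ a) = x • matRep (Fin n) c (algebraMap F L) hs a := by
    intro x a
    refine (Algebra.TensorProduct.lift_tmul _ _ _ _ _).trans ?_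
    rw [Algebra.smul_def]
    rfl
  have hentry : ∀ i j x q i' p j' p', Ψ (x ⊗ₜ Matrix.single i j q) (i', p) (j', p')
      = if i = i' ∧ j = j' then x * splitRep c (algebraMap F L) hs q p p' else 0 := by
    intro i j x q i' p j' p'
    rw [hΨ, Matrix.smul_apply, matRep_apply, Matrix.single_apply]
    split_ifs <;> simp
  have hcomb : ∀ i j p q r t, Ψ (p ⊗ₜ Matrix.single i j 1 + q ⊗ₜ Matrix.single i j ⟨0, 1, 0, 0⟩
      + r ⊗ₜ Matrix.single i j ⟨0, 0, 1, 0⟩ + t ⊗ₜ Matrix.single i j ⟨0, 0, 0, 1⟩)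
      = Matrix.single (i, 0) (j, 0) (p + s * q)
        + Matrix.single (i, 0) (j, 1) (algebraMap F L c * (r + s * t))
        + Matrix.single (i, 1) (j, 0) (r - s * t) + Matrix.single (i, 1) (j, 1) (p - s * q) := by
    intro i j p q r t
    ext ⟨i', a⟩ ⟨j', a'⟩
    simp only [map_add, Matrix.add_apply, hentry, Matrix.single_apply, Prod.mk.injEq]
    by_cases h : i = i' ∧ j = j'
    · obtain ⟨rfl, rfl⟩ := h
      fin_cases a <;> fin_cases a' <;> simp [splitRep] <;> ring
    · have h1 : ∀ P Q : Prop, ¬ ((i = i' ∧ P) ∧ (j = j' ∧ Q)) := by tauto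
      simp [h, h1]
  have hsingle : ∀ i j x, Matrix.single i j x ∈ Ψ.range := by
    rintro ⟨i, a⟩ ⟨j, a'⟩ x
    have hx : x / 2 + x / 2 = x := by field_simp; norm_num
    fin_cases a <;> fin_cases a'
    · refine ⟨_, (hcomb i j (x / 2) (s⁻¹ * (x / 2)) 0 0).trans ?_⟩
      simp [hs0, hx]
    · refine ⟨_, (hcomb i j 0 0 ((algebraMap F L c)⁻¹ * (x / 2))
        ((algebraMap F L c)⁻¹ * (s⁻¹ * (x / 2)))).trans ?_⟩
      have h1 : algebraMap F L c * ((algebraMap F L c)⁻¹ * (x / 2)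
          + s * ((algebraMap F L c)⁻¹ * (s⁻¹ * (x / 2)))) = x := by
        field_simp; norm_num
      have h2 : (algebraMap F L c)⁻¹ * (x / 2) - s * ((algebraMap F L c)⁻¹ * (s⁻¹ * (x / 2)))
          = 0 := by
        field_simp; ring
      rw [h1, h2]
      simp
    · refine ⟨_, (hcomb i j 0 0 (x / 2) (-(s⁻¹ * (x / 2)))).trans ?_⟩
      simp [hs0, hx]
    · refine ⟨_, (hcomb i j (x / 2) (-(s⁻¹ * (x / 2))) 0 0).trans ?_⟩
      simp [hs0, hx]
  have hsurj : Function.Surjective Ψ := by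
    intro m
    change m ∈ Ψ.range
    rw [Matrix.matrix_eq_sum_single m]
    exact sum_mem fun i _ => sum_mem fun j _ => hsingle i j _
  have hinj : Function.Injective Ψ :=
    (LinearMap.injective_iff_surjective_of_finrank_eq_finrank (f := Ψ.toLinearMap) (by
      rw [Module.finrank_baseChange, finrank_matrix_quaternion, Module.finrank_matrix]
      simp)).2 hsurj
  have hbij : Function.Bijective Ψ := ⟨hinj, hsurj⟩
  refine ⟨L, _, _, n * 2, (AlgEquiv.ofBijective Ψ hbij).trans
    (Matrix.reindexAlgEquiv L L finProdFinEquiv), ?_⟩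
  rw [← h, AlgEquiv.trans_apply, Matrix.det_reindexAlgEquiv, AlgEquiv.ofBijective_apply, hΨ,
    one_smul]
  rfl

end Existence

section Hermitian
variable {F M : Type*} [Field F] [Field M] {b c : F} {f : F →+* M} {s : M} (hs : s ^ 2 = f b)

theorem detRep_submatrix {α β : Type*} [Fintype α] [DecidableEq α] [Fintype β] [DecidableEq β]
    (e : α ≃ β) (S : Matrix β β ℍ[F,b,c]) : detRep f hs (S.submatrix e e) = detRep f hs S :=
  Matrix.det_submatrix_equiv_self (e.prodCongr (Equiv.refl (Fin 2))) (matRep β c f hs S)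

/-- The added block factors as `UV` with `VU = 0`, and `det (1 + UV) = det (1 + VU)`. -/
theorem detRep_one_add_single {α : Type*} [Fintype α] [DecidableEq α] {i j : α} (hij : i ≠ j)
    (x : ℍ[F,b,c]) : detRep f hs (1 + Matrix.single i j x) = 1 := by
  let U : Matrix (α × Fin 2) (Fin 2) M :=
    Matrix.of fun k a => if k.1 = i then splitRep c f hs x k.2 a else 0
  let V : Matrix (Fin 2) (α × Fin 2) M :=
    Matrix.of fun a k => if k.1 = j then (1 : Matrix (Fin 2) (Fin 2) M) a k.2 else 0
  have h : matRep α c f hs (1 + Matrix.single i j x) = 1 + U * V := by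
    rw [map_add, map_one]
    congr 1
    ext ⟨k, a⟩ ⟨l, a'⟩
    rw [matRep_apply, Matrix.mul_apply]
    by_cases hk : k = i
    · by_cases hl : l = j
      · subst hk hl
        simp [U, V, Matrix.one_apply]
      · simp [U, V, hl, Ne.symm hl]
    · simp [U, V, hk, Ne.symm hk]
  have hVU : V * U = 0 := by
    ext a a'
    rw [Matrix.mul_apply]
    refine Finset.sum_eq_zero fun k _ => ?_
    by_cases hk : k.1 = j
    · have : k.1 ≠ i := by rw [hk]; exact hij.symm
      simp [U, this]
    · simp [V, hk]
  rw [detRep, h, Matrix.det_one_add_mul_comm, hVU, add_zero, Matrix.det_one]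

theorem eq_algebraMap_re_of_star_eq (h2 : (2 : F) ≠ 0) {x : ℍ[F,b,c]} (h : star x = x) :
    x = algebraMap F _ x.re := by
  simp only [QuaternionAlgebra.ext_iff, imI_star, imJ_star, imK_star] at h
  have key : ∀ y : F, -y = y → y = 0 := fun y hy =>
    (mul_eq_zero.1 (show 2 * y = 0 by linear_combination -hy)).resolve_left h2
  ext
  · simp [QuaternionAlgebra.algebraMap_eq]
  · simp [QuaternionAlgebra.algebraMap_eq, key _ h.2.1]
  · simp [QuaternionAlgebra.algebraMap_eq, key _ h.2.2.1]
  · simp [QuaternionAlgebra.algebraMap_eq, key _ h.2.2.2]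

/-- The Schur complement of a scalar pivot `d`, which occupies a `2 × 2` scalar block and so
contributes `d²`. -/
theorem detRep_option {α : Type*} [Fintype α] [DecidableEq α]
    (S : Matrix (Option α) (Option α) ℍ[F,b,c]) {d : F} (hd : d ≠ 0)
    (hS : S none none = algebraMap F _ d) :
    detRep f hs S = f d ^ 2 * detRep f hs (Matrix.of fun i j : α =>
      S (some i) (some j) - algebraMap F _ d⁻¹ * (S (some i) none * S none (some j))) := by
  let ρ := splitRep c f hs
  let A : Matrix (Fin 2) (Fin 2) M := algebraMap M _ (f d)
  let B : Matrix (Fin 2) (α × Fin 2) M := Matrix.of fun a j => ρ (S none (some j.1)) a j.2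
  let C : Matrix (α × Fin 2) (Fin 2) M := Matrix.of fun i a => ρ (S (some i.1) none) i.2 a
  let D : Matrix (α × Fin 2) (α × Fin 2) M :=
    Matrix.of fun i j => ρ (S (some i.1) (some j.1)) i.2 j.2
  have hfd : f d ≠ 0 := (map_ne_zero f).2 hd
  let _ : Invertible A :=
    ⟨algebraMap M _ (f d)⁻¹, by rw [← map_mul, inv_mul_cancel₀ hfd, map_one],
      by rw [← map_mul, mul_inv_cancel₀ hfd, map_one]⟩
  let e : Fin 2 ⊕ (α × Fin 2) ≃ Option α × Fin 2 :=
    { toFun := Sum.elim (fun a => (none, a)) (fun i => (some i.1, i.2))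
      invFun := fun i => i.1.elim (Sum.inl i.2) (fun k => Sum.inr (k, i.2))
      left_inv := by rintro (a | ⟨i, a⟩) <;> rfl
      right_inv := by rintro ⟨(_ | i), a⟩ <;> rfl }
  have h1 : (matRep (Option α) c f hs S).submatrix e e = Matrix.fromBlocks A B C D := by
    ext (a | ⟨i, a⟩) (a' | ⟨j, a'⟩)
    · change splitRep c f hs (S none none) a a' = A a a'
      rw [hS, splitRep_algebraMap]
    · rfl
    · rfl
    · rfl
  rw [detRep, ← Matrix.det_submatrix_equiv_self e, h1, Matrix.det_fromBlocks₁₁]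
  congr 1
  · simp [A, Matrix.algebraMap_eq_diagonal, Matrix.det_diagonal]
  · rw [detRep]
    congr 1
    ext ⟨i, a⟩ ⟨j, a'⟩
    have hA : ⅟A = algebraMap M _ (f d)⁻¹ := rfl
    rw [matRep_apply, Matrix.of_apply, map_sub, map_mul, map_mul, splitRep_algebraMap,
      Matrix.sub_apply, Matrix.sub_apply, hA, Algebra.algebraMap_eq_smul_one,
      Matrix.mul_smul, Matrix.mul_one, ← Algebra.smul_def, Matrix.smul_mul, Matrix.smul_apply,
      Matrix.smul_apply, map_inv₀,
      Matrix.mul_apply, Matrix.mul_apply]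
    rfl

theorem exists_re_mul_ne_zero (hb : b ≠ 0) (hc : c ≠ 0) {y : ℍ[F,b,c]} (hy : y ≠ 0) :
    ∃ x : ℍ[F,b,c], (y * x).re ≠ 0 := by
  by_contra! h
  refine hy ?_
  have h0 := h ⟨1, 0, 0, 0⟩
  have h1 := h ⟨0, 1, 0, 0⟩
  have h2 := h ⟨0, 0, 1, 0⟩
  have h3 := h ⟨0, 0, 0, 1⟩
  simp [hb, hc] at h0 h1 h2 h3
  ext <;> simp [h0, h1, h2, h3]

/-- Hermitian elimination: diagonal entries are fixed by the involution, hence scalars, and the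
Schur complement of a nonzero one is again hermitian, so each pivot contributes a square. -/
theorem exists_detRep_eq_sq (h2 : (2 : F) ≠ 0) (hb : b ≠ 0) (hc : c ≠ 0) {ι : Type*} [Fintype ι]
    [DecidableEq ι] (S : Matrix ι ι ℍ[F,b,c]) (hS : S.conjTranspose = S) :
    ∃ r : F, detRep f hs S = f r ^ 2 := by
  refine Fintype.induction_empty_option (P := fun α _ => ∀ [DecidableEq α]
    (S : Matrix α α ℍ[F,b,c]) (_ : S.conjTranspose = S), ∃ r : F, detRep f hs S = f r ^ 2)
    ?_ ?_ ?_ ι S hS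
  · intro α β _ e ih _ S hS
    let _ : Fintype α := Fintype.ofEquiv β e.symm
    classical
    obtain ⟨r, hr⟩ := ih (S.submatrix e e) (by rw [Matrix.conjTranspose_submatrix, hS])
    exact ⟨r, by rw [← hr, detRep_submatrix]⟩
  · intro _ S hS
    exact ⟨1, by simp [detRep]⟩
  · intro α _ ih _ S hS
    classical
    have key0 : ∀ S : Matrix (Option α) (Option α) ℍ[F,b,c], S.conjTranspose = S →
        S none none ≠ 0 → ∃ r : F, detRep f hs S = f r ^ 2 := by
      intro S hS h0
      have hSij : ∀ i j, star (S i j) = S j i := fun i j => by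
        rw [← Matrix.conjTranspose_apply, hS]
      have hd := eq_algebraMap_re_of_star_eq h2 (hSij none none)
      have hd0 : (S none none).re ≠ 0 := by
        intro h; rw [h, map_zero] at hd; exact h0 hd
      obtain ⟨r, hr⟩ := ih (Matrix.of fun i j : α =>
        S (some i) (some j) - algebraMap F _ (S none none).re⁻¹
          * (S (some i) none * S none (some j))) (by
        ext1 i j
        rw [Matrix.conjTranspose_apply, Matrix.of_apply, Matrix.of_apply, star_sub, star_mul,
          star_mul, hSij, hSij, hSij, coe_algebraMap, star_coe, ← coe_commutes])
      refine ⟨(S none none).re * r, ?_⟩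
      rw [map_mul, mul_pow, ← hr, ← detRep_option hs S hd0 hd]
      congr!
    have key1 : ∀ S : Matrix (Option α) (Option α) ℍ[F,b,c], S.conjTranspose = S →
        ∀ i, S i i ≠ 0 → ∃ r : F, detRep f hs S = f r ^ 2 := by
      intro S hS i hi
      obtain ⟨r, hr⟩ := key0 (S.submatrix (Equiv.swap none i) (Equiv.swap none i))
        (by rw [Matrix.conjTranspose_submatrix, hS]) (by simpa)
      exact ⟨r, by rw [← hr, detRep_submatrix]⟩
    by_cases h : ∃ i, S i i ≠ 0
    · obtain ⟨i, hi⟩ := h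
      exact key1 S hS i hi
    · push Not at h
      by_cases h0 : S = 0
      · exact ⟨0, by simp [h0, detRep]⟩
      · obtain ⟨i, j, hij⟩ : ∃ i j, S i j ≠ 0 := by
          by_contra! hcon
          exact h0 (by ext1 i j; exact hcon i j)
        have hne : j ≠ i := by rintro rfl; exact hij (h _)
        obtain ⟨x, hx⟩ := exists_re_mul_ne_zero hb hc hij
        -- With zero diagonal, congruence by this transvection creates the diagonal entry `y + ȳ`
        -- where `y = Sᵢⱼx`. It is twice the scalar part of `y`, which `x` was chosen to make
        -- nonzero.
        set P : Matrix (Option α) (Option α) ℍ[F,b,c] := 1 + Matrix.single j i x with hP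
        have hPt : P.conjTranspose = 1 + Matrix.single i j (star x) := by
          rw [hP, Matrix.conjTranspose_add, Matrix.conjTranspose_one,
            Matrix.conjTranspose_single]
        have hdet : detRep f hs (P.conjTranspose * S * P) = detRep f hs S := by
          rw [detRep_mul, detRep_mul, hPt, detRep_one_add_single hs hne.symm,
            detRep_one_add_single hs hne, one_mul, mul_one]
        rw [← hdet]
        refine key1 _ (by
          rw [Matrix.conjTranspose_mul, Matrix.conjTranspose_mul, hS,
            Matrix.conjTranspose_conjTranspose, mul_assoc]) i ?_
        have hji : S j i = star (S i j) := by rw [← Matrix.conjTranspose_apply, hS]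
        have hval : (P.conjTranspose * S * P) i i = star x * S j i + S i j * x := by
          rw [hPt, hP]
          simp [add_mul, mul_add, h]
        rw [hval, hji, ← star_mul]
        intro hcon
        have := congr_arg QuaternionAlgebra.re hcon
        rw [re_add, re_star] at this
        refine hx ((mul_eq_zero.1 (show 2 * (S i j * x).re = 0 from ?_)).resolve_left h2)
        rw [re_zero] at this
        linear_combination this

end Hermitian
end QuaternionAlgebra
end

/-! ### Hahn series: integrality, residues, doubling of exponents. -/

noncomputable section

namespace HahnSeries
variable {Γ : Type*} [AddCommGroup Γ] [LinearOrder Γ] [IsOrderedAddMonoid Γ]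
variable {R S : Type*} [CommRing R] [CommRing S]

theorem coeff_mul_eq_zero_of_lt {x y : HahnSeries Γ R} {α β : Γ}
    (hx : ∀ γ < α, x.coeff γ = 0) (hy : ∀ γ < β, y.coeff γ = 0) :
    ∀ γ < α + β, (x * y).coeff γ = 0 := by
  intro γ hγ
  rw [coeff_mul]
  refine Finset.sum_eq_zero fun p hp => ?_
  obtain ⟨h1, h2, h3⟩ := Finset.mem_antidiagonal.1 hp
  rcases lt_or_ge p.1 α with h | h
  · rw [hx _ h, zero_mul]
  rcases lt_or_ge p.2 β with h' | h'
  · rw [hy _ h', mul_zero]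
  · exact absurd (add_le_add h h') (by rw [h3]; exact not_le.2 hγ)

/-- The only way to write `α + β` as a sum of exponents at least `α` and at least `β` is the obvious
one. -/
theorem coeff_mul_of_forall_lt {x y : HahnSeries Γ R} {α β : Γ}
    (hx : ∀ γ < α, x.coeff γ = 0) (hy : ∀ γ < β, y.coeff γ = 0) :
    (x * y).coeff (α + β) = x.coeff α * y.coeff β := by
  rw [coeff_mul]
  rw [Finset.sum_eq_single (α, β)]
  · intro p hp hne
    obtain ⟨h1, h2, h3⟩ := Finset.mem_antidiagonal.1 hp
    rcases lt_or_ge p.1 α with h | h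
    · rw [hx _ h, zero_mul]
    rcases lt_or_ge p.2 β with h' | h'
    · rw [hy _ h', mul_zero]
    · exfalso
      have h4 : p.1 = α := by
        refine le_antisymm ?_ h
        by_contra! hlt
        exact absurd h3 (add_lt_add_of_lt_of_le hlt h').ne'
      have h5 : p.2 = β := by rw [h4] at h3; exact add_left_cancel h3
      exact hne (Prod.ext h4 h5)
  · intro h
    by_contra hne
    refine h (Finset.mem_antidiagonal.2 ⟨?_, ?_, rfl⟩)
    · intro h0; simp [h0] at hne
    · intro h0; simp [h0] at hne

variable (Γ R) in
/-- The Hahn series with support in the nonnegative cone. -/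
def integers : Subring (HahnSeries Γ R) where
  carrier := {x | ∀ γ < 0, x.coeff γ = 0}
  mul_mem' := by
    intro x y hx hy γ hγ
    exact coeff_mul_eq_zero_of_lt hx hy γ (by simpa using hγ)
  one_mem' := by
    intro γ hγ
    rw [coeff_one, if_neg hγ.ne]
  add_mem' := by
    intro x y hx hy γ hγ
    rw [coeff_add, hx γ hγ, hy γ hγ, add_zero]
  zero_mem' := by simp
  neg_mem' := by
    intro x hx γ hγ
    rw [coeff_neg, hx γ hγ, neg_zero]

/-- The constant coefficient of a Hahn series with nonnegative support. -/
def residue : integers Γ R →+* R where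
  toFun x := x.1.coeff 0
  map_one' := by simp
  map_zero' := by simp
  map_add' x y := by simp
  map_mul' x y := by
    have := coeff_mul_of_forall_lt x.2 y.2
    rwa [add_zero] at this

theorem coeff_zero_det {ι : Type*} [Fintype ι] [DecidableEq ι] (N : Matrix ι ι (HahnSeries Γ R))
    (hN : ∀ i j, N i j ∈ integers Γ R) : N.det.coeff 0 = (N.map fun x => x.coeff 0).det := by
  let N' : Matrix ι ι (integers Γ R) := Matrix.of fun i j => ⟨N i j, hN i j⟩
  have h1 : N = (integers Γ R).subtype.mapMatrix N' := rfl
  have h2 : (N.map fun x => x.coeff 0) = residue.mapMatrix N' := rfl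
  rw [h2, ← RingHom.map_det, h1, ← RingHom.map_det]
  rfl

theorem coeff_zero_pow {x : HahnSeries Γ R} (hx : x ∈ integers Γ R) (n : ℕ) :
    (x ^ n).coeff 0 = x.coeff 0 ^ n :=
  map_pow residue ⟨x, hx⟩ n

variable (Γ) in
/-- The map on Hahn series induced by a homomorphism of the coefficients. -/
def mapRingHom (f : R →+* S) : HahnSeries Γ R →+* HahnSeries Γ S where
  toFun x := x.map f
  map_one' := HahnSeries.map_one f.toMonoidWithZeroHom
  map_zero' := by ext; simp
  map_add' x y := HahnSeries.map_add f.toAddMonoidHom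
  map_mul' x y := HahnSeries.map_mul f.toNonUnitalRingHom

theorem coeff_mapRingHom (f : R →+* S) (x : HahnSeries Γ R) (γ : Γ) :
    (mapRingHom Γ f x).coeff γ = f (x.coeff γ) := rfl

theorem mapRingHom_C (f : R →+* S) (r : R) : mapRingHom Γ f (C r) = C (f r) := by
  ext γ
  rw [coeff_mapRingHom]
  simp only [C_apply, coeff_single]
  split_ifs <;> simp

variable (Γ R) in
/-- The endomorphism `t ^ γ ↦ t ^ (2 γ)` of a ring of Hahn series. -/
def doubling : HahnSeries Γ R →+* HahnSeries Γ R :=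
  embDomainRingHom (nsmulAddMonoidHom (α := Γ) 2)
    (fun _ _ h => nsmul_right_injective two_ne_zero h)
    (fun _ _ => nsmul_le_nsmul_iff_right two_ne_zero)

theorem doubling_C (r : R) : doubling Γ R (C r) = C r := embDomainRingHom_C

theorem coeff_doubling (x : HahnSeries Γ R) (γ : Γ) :
    (doubling Γ R x).coeff (2 • γ) = x.coeff γ :=
  embDomain_coeff (a := γ)

theorem exists_of_coeff_doubling_ne_zero {x : HahnSeries Γ R} {γ : Γ}
    (h : (doubling Γ R x).coeff γ ≠ 0) : ∃ δ, γ = 2 • δ := by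
  by_contra hcon
  refine h (embDomain_of_notMem_range ?_)
  rintro ⟨δ, hδ⟩
  exact hcon ⟨δ, hδ.symm⟩

theorem doubling_single (γ : Γ) (r : R) :
    doubling Γ R (single γ r) = single (2 • γ) r := embDomain_single

end HahnSeries

namespace QuaternionAlgebra
open HahnSeries
variable {Γ : Type*} [AddCommGroup Γ] [LinearOrder Γ] [IsOrderedAddMonoid Γ]
variable {R : Type*} [CommRing R] {b c : R}

/-- The coefficients of a quaternion over a ring of Hahn series. -/
def coeffHom (b c : R) (γ : Γ) :
    ℍ[HahnSeries Γ R,(C b : HahnSeries Γ R),(C c : HahnSeries Γ R)] →+ ℍ[R,b,c] where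
  toFun x := ⟨x.re.coeff γ, x.imI.coeff γ, x.imJ.coeff γ, x.imK.coeff γ⟩
  map_zero' := by ext <;> simp
  map_add' x y := by ext <;> simp

variable {x y : ℍ[HahnSeries Γ R,(C b : HahnSeries Γ R),(C c : HahnSeries Γ R)]}

theorem coeffHom_eq_zero_iff {γ : Γ} : coeffHom b c γ x = 0 ↔ x.re.coeff γ = 0 ∧
    x.imI.coeff γ = 0 ∧ x.imJ.coeff γ = 0 ∧ x.imK.coeff γ = 0 := by
  simp [QuaternionAlgebra.ext_iff, coeffHom]

theorem forall_coeffHom_eq_zero_iff {α : Γ} : (∀ γ < α, coeffHom b c γ x = 0) ↔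
    (∀ γ < α, x.re.coeff γ = 0) ∧ (∀ γ < α, x.imI.coeff γ = 0) ∧
    (∀ γ < α, x.imJ.coeff γ = 0) ∧ (∀ γ < α, x.imK.coeff γ = 0) := by
  simp only [coeffHom_eq_zero_iff]
  exact ⟨fun h => ⟨fun γ hγ => (h γ hγ).1, fun γ hγ => (h γ hγ).2.1, fun γ hγ => (h γ hγ).2.2.1,
    fun γ hγ => (h γ hγ).2.2.2⟩, fun h γ hγ => ⟨h.1 γ hγ, h.2.1 γ hγ, h.2.2.1 γ hγ, h.2.2.2 γ hγ⟩⟩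

theorem coeffHom_mul_eq_zero_of_lt {α β : Γ} (hx : ∀ γ < α, coeffHom b c γ x = 0)
    (hy : ∀ γ < β, coeffHom b c γ y = 0) : ∀ γ < α + β, coeffHom b c γ (x * y) = 0 := by
  intro γ hγ
  obtain ⟨x0, x1, x2, x3⟩ := forall_coeffHom_eq_zero_iff.1 hx
  obtain ⟨y0, y1, y2, y3⟩ := forall_coeffHom_eq_zero_iff.1 hy
  simp only [coeffHom_eq_zero_iff, re_mul, imI_mul, imJ_mul, imK_mul, mul_assoc, C_mul_eq_smul]
  simp [coeff_mul_eq_zero_of_lt x0 y0 γ hγ, coeff_mul_eq_zero_of_lt x0 y1 γ hγ,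
    coeff_mul_eq_zero_of_lt x0 y2 γ hγ, coeff_mul_eq_zero_of_lt x0 y3 γ hγ,
    coeff_mul_eq_zero_of_lt x1 y0 γ hγ, coeff_mul_eq_zero_of_lt x1 y1 γ hγ,
    coeff_mul_eq_zero_of_lt x1 y2 γ hγ, coeff_mul_eq_zero_of_lt x1 y3 γ hγ,
    coeff_mul_eq_zero_of_lt x2 y0 γ hγ, coeff_mul_eq_zero_of_lt x2 y1 γ hγ,
    coeff_mul_eq_zero_of_lt x2 y2 γ hγ, coeff_mul_eq_zero_of_lt x2 y3 γ hγ,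
    coeff_mul_eq_zero_of_lt x3 y0 γ hγ, coeff_mul_eq_zero_of_lt x3 y1 γ hγ,
    coeff_mul_eq_zero_of_lt x3 y2 γ hγ, coeff_mul_eq_zero_of_lt x3 y3 γ hγ]

theorem coeffHom_mul {α β : Γ} (hx : ∀ γ < α, coeffHom b c γ x = 0)
    (hy : ∀ γ < β, coeffHom b c γ y = 0) :
    coeffHom b c (α + β) (x * y) = coeffHom b c α x * coeffHom b c β y := by
  obtain ⟨x0, x1, x2, x3⟩ := forall_coeffHom_eq_zero_iff.1 hx
  obtain ⟨y0, y1, y2, y3⟩ := forall_coeffHom_eq_zero_iff.1 hy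
  ext <;> simp only [coeffHom, AddMonoidHom.coe_mk, ZeroHom.coe_mk, re_mul, imI_mul, imJ_mul,
      imK_mul, mul_assoc, C_mul_eq_smul] <;>
    simp [coeff_mul_of_forall_lt x0 y0, coeff_mul_of_forall_lt x0 y1,
    coeff_mul_of_forall_lt x0 y2, coeff_mul_of_forall_lt x0 y3,
    coeff_mul_of_forall_lt x1 y0, coeff_mul_of_forall_lt x1 y1,
    coeff_mul_of_forall_lt x1 y2, coeff_mul_of_forall_lt x1 y3,
    coeff_mul_of_forall_lt x2 y0, coeff_mul_of_forall_lt x2 y1,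
    coeff_mul_of_forall_lt x2 y2, coeff_mul_of_forall_lt x2 y3,
    coeff_mul_of_forall_lt x3 y0, coeff_mul_of_forall_lt x3 y1,
    coeff_mul_of_forall_lt x3 y2, coeff_mul_of_forall_lt x3 y3]

theorem coeffHom_star (γ : Γ) : coeffHom b c γ (star x) = star (coeffHom b c γ x) := by
  ext <;> simp [coeffHom]

/-- The inclusion of constants. -/
abbrev constHom (Γ : Type*) [AddCommGroup Γ] [LinearOrder Γ] [IsOrderedAddMonoid Γ] (b c : R) :
    ℍ[R,b,c] →+* ℍ[HahnSeries Γ R,(C b : HahnSeries Γ R),(C c : HahnSeries Γ R)] :=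
  mapHom C rfl rfl

theorem coeffHom_zero_constHom (q : ℍ[R,b,c]) : coeffHom b c (0 : Γ) (constHom Γ b c q) = q := by
  ext <;> simp [coeffHom]

theorem coeffHom_constHom_of_ne (q : ℍ[R,b,c]) {γ : Γ} (h : γ ≠ 0) :
    coeffHom b c γ (constHom Γ b c q) = 0 := by
  ext <;> simp [coeffHom, h]

theorem coeffHom_single_smul (α γ : Γ) :
    coeffHom b c γ ((single α (1 : R) : HahnSeries Γ R) • x) = coeffHom b c (γ - α) x := by
  ext <;> simp [coeffHom, coeff_single_mul]

theorem coeffHom_smul_constHom (μ : HahnSeries Γ R) (γ : Γ) (q : ℍ[R,b,c]) :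
    coeffHom b c γ (μ • constHom Γ b c q) = μ.coeff γ • q := by
  ext <;> simp [coeffHom, mul_comm μ, mul_comm (μ.coeff γ)]

theorem coeffHom_star_mul_constHom_mul {α : Γ} (hx : ∀ γ < α, coeffHom b c γ x = 0)
    (hy : ∀ γ < α, coeffHom b c γ y = 0) (q : ℍ[R,b,c]) :
    coeffHom b c (α + α) (star x * constHom Γ b c q * y)
      = star (coeffHom b c α x) * q * coeffHom b c α y := by
  have h1 : ∀ γ < α, coeffHom b c γ (star x) = 0 := fun γ hγ => by
    rw [coeffHom_star, hx γ hγ, star_zero]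
  have h2 : ∀ γ < (0 : Γ), coeffHom b c γ (constHom Γ b c q) = 0 := fun γ hγ =>
    coeffHom_constHom_of_ne q hγ.ne
  have h3 := coeffHom_mul_eq_zero_of_lt h1 h2
  have h4 := coeffHom_mul h1 h2
  rw [add_zero] at h3 h4
  rw [coeffHom_mul h3 hy, h4, coeffHom_star, coeffHom_zero_constHom]

end QuaternionAlgebra
end

/-! ### Residues of similitudes of the generic form. -/

noncomputable section

namespace QuaternionAlgebra
open HahnSeries
variable {Γ : Type*} [AddCommGroup Γ] [LinearOrder Γ] [IsOrderedAddMonoid Γ]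
variable {F : Type*} [Field F] {b c : F} {n : ℕ}

theorem eq_zero_of_star_mul_mul_eq_zero (hdiv : IsQuatDivision b c) {q z : ℍ[F,b,c]} (hq : q ≠ 0)
    (h : star z * q * z = 0) : z = 0 := by
  by_contra hz
  have := congr_arg nrd h
  rw [nrd_mul, nrd_mul, nrd_star, nrd_zero] at this
  simp [nrd_ne_zero_of_isUnit (hdiv z hz), nrd_ne_zero_of_isUnit (hdiv q hq)] at this

theorem isPWO_coeffHom_ne_zero
    (x : ℍ[HahnSeries Γ F,(C b : HahnSeries Γ F),(C c : HahnSeries Γ F)]) :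
    {γ | coeffHom b c γ x ≠ 0}.IsPWO := by
  refine (((x.re.isPWO_support.union x.imI.isPWO_support).union
    x.imJ.isPWO_support).union x.imK.isPWO_support).mono fun γ hγ => ?_
  rw [Set.mem_ofPred_eq, Ne, coeffHom_eq_zero_iff] at hγ
  simp only [Set.mem_union, mem_support]
  tauto

/-- Look at the least exponent `δ` in column `j` and suppose `δ < 0`. The cosets `eᵢ - eⱼ - w + 2Γ`
are distinct, so only one entry has a term there, and it contributes `z̄qz ≠ 0` at exponent `2δ`,
where the right-hand side vanishes. -/
theorem forall_coeffHom_eq_zero_of_similitude (hdiv : IsQuatDivision b c) {e : Fin n → Γ}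
    {q : Fin n → ℍ[F,b,c]} (hq : ∀ i, q i ≠ 0)
    (he : ∀ i j, (∃ δ, e i - e j = 2 • δ) → i = j) {w : Γ} {μ : HahnSeries Γ F}
    (hμ : μ ∈ integers Γ F)
    (G : Matrix (Fin n) (Fin n) ℍ[HahnSeries Γ F,(C b : HahnSeries Γ F),(C c : HahnSeries Γ F)])
    (hG : ∀ j, ∑ i, star (G i j) * constHom Γ b c (q i) * G i j = μ • constHom Γ b c (q j))
    (hsupp : ∀ i j γ, coeffHom b c γ (G i j) ≠ 0 → ∃ δ, γ = e i - e j - w + 2 • δ) (i j : Fin n) :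
    ∀ γ < 0, coeffHom b c γ (G i j) = 0 := by
  by_contra! hcon
  obtain ⟨γ, hγ, hne⟩ := hcon
  let T : Set Γ := ⋃ i ∈ (Finset.univ : Finset (Fin n)), {γ | coeffHom b c γ (G i j) ≠ 0}
  have hT : T.IsWF := Set.IsPWO.isWF
    ((Finset.isPWO_bUnion _).2 fun i _ => isPWO_coeffHom_ne_zero (G i j))
  have hTmem : ∀ {γ}, γ ∈ T ↔ ∃ i, coeffHom b c γ (G i j) ≠ 0 := by simp [T]
  have hTn : T.Nonempty := ⟨γ, hTmem.2 ⟨i, hne⟩⟩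
  set δ := hT.min hTn with hδ
  have hlow : ∀ i, ∀ γ < δ, coeffHom b c γ (G i j) = 0 := by
    intro i γ hγ
    by_contra h
    exact absurd (hT.min_le hTn (hTmem.2 ⟨i, h⟩)) (not_le.2 hγ)
  have hδ0 : δ < 0 := (hT.min_le hTn (hTmem.2 ⟨i, hne⟩)).trans_lt hγ
  obtain ⟨i₀, hi₀⟩ := hTmem.1 (hT.min_mem hTn)
  rw [← hδ] at hi₀
  have hother : ∀ i, i ≠ i₀ → coeffHom b c δ (G i j) = 0 := by
    intro i hi
    by_contra h
    refine hi (he _ _ ?_)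
    obtain ⟨δ₁, h₁⟩ := hsupp _ _ _ h
    obtain ⟨δ₂, h₂⟩ := hsupp _ _ _ hi₀
    refine ⟨δ₂ - δ₁, ?_⟩
    rw [h₁] at h₂
    rw [nsmul_sub]
    have := sub_eq_zero.2 h₂
    rw [← sub_eq_zero, ← this]
    module
  have h1 := congr_arg (coeffHom b c (δ + δ)) (hG j)
  rw [map_sum, Finset.sum_eq_single i₀, coeffHom_star_mul_constHom_mul (hlow _) (hlow _),
    coeffHom_smul_constHom, hμ _ (add_neg hδ0 hδ0), zero_smul] at h1
  · exact hi₀ (eq_zero_of_star_mul_mul_eq_zero hdiv (hq _) h1)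
  · intro i _ hi
    rw [coeffHom_star_mul_constHom_mul (hlow _) (hlow _), hother i hi, mul_zero]
  · simp

/-- A nonzero constant term at `(i, j)` forces `w ≡ eᵢ - eⱼ` modulo `2Γ`, and every column has one
because `μ.coeff 0 ≠ 0`. Comparing columns through the independence of the `eᵢ` leaves only the
diagonal. -/
theorem residue_of_similitude (hn : 3 ≤ n) (hdiv : IsQuatDivision b c) {e : Fin n → Γ}
    {q : Fin n → ℍ[F,b,c]} (hq : ∀ i, q i ≠ 0)
    (he : ∀ i j k l, (∃ δ, e i + e j - e k - e l = 2 • δ) →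
      (i = j ∧ k = l) ∨ (i = k ∧ j = l) ∨ (i = l ∧ j = k)) {w : Γ} {μ : HahnSeries Γ F}
    (hμ : μ ∈ integers Γ F) (hμ0 : μ.coeff 0 ≠ 0)
    (G : Matrix (Fin n) (Fin n) ℍ[HahnSeries Γ F,(C b : HahnSeries Γ F),(C c : HahnSeries Γ F)])
    (hG : ∀ j, ∑ i, star (G i j) * constHom Γ b c (q i) * G i j = μ • constHom Γ b c (q j))
    (hsupp : ∀ i j γ, coeffHom b c γ (G i j) ≠ 0 → ∃ δ, γ = e i - e j - w + 2 • δ) :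
    (∀ i j, ∀ γ < 0, coeffHom b c γ (G i j) = 0) ∧
    (∀ i j, i ≠ j → coeffHom b c 0 (G i j) = 0) ∧
    ∀ j, star (coeffHom b c 0 (G j j)) * q j * coeffHom b c 0 (G j j)
      = algebraMap F _ (μ.coeff 0) * q j := by
  have hint := forall_coeffHom_eq_zero_of_similitude hdiv hq (fun i j ⟨δ, hδ⟩ => by
    rcases he i i j j ⟨2 • δ, by rw [← hδ]; abel⟩ with h | h | h
    · rcases he i j j j ⟨δ, by rw [← hδ]; abel⟩ with h' | h' | h' <;> tauto
    · exact h.1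
    · exact h.1) hμ G hG hsupp
  have hsum : ∀ j, ∑ i, star (coeffHom b c 0 (G i j)) * q i * coeffHom b c 0 (G i j)
      = algebraMap F _ (μ.coeff 0) * q j := by
    intro j
    have h1 := congr_arg (coeffHom b c (0 + 0)) (hG j)
    rw [map_sum, coeffHom_smul_constHom, add_zero, Algebra.smul_def] at h1
    rw [← h1]
    refine Finset.sum_congr rfl fun i _ => ?_
    rw [← coeffHom_star_mul_constHom_mul (hint i j) (hint i j), add_zero]
  have hex : ∀ j, ∃ i, coeffHom b c 0 (G i j) ≠ 0 := by
    intro j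
    by_contra! h
    have := hsum j
    simp only [h, mul_zero, Finset.sum_const_zero] at this
    rw [← Algebra.smul_def] at this
    exact smul_ne_zero hμ0 (hq j) this.symm
  choose π hπ using hex
  have hkey : ∀ i j i' j', coeffHom b c 0 (G i j) ≠ 0 → coeffHom b c 0 (G i' j') ≠ 0 →
      (i = j' ∧ j = i') ∨ (i = j ∧ j' = i') ∨ (i = i' ∧ j' = j) := by
    intro i j i' j' h h'
    obtain ⟨δ₁, h₁⟩ := hsupp _ _ _ h
    obtain ⟨δ₂, h₂⟩ := hsupp _ _ _ h'
    refine he i j' j i' ⟨δ₂ - δ₁, ?_⟩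
    rw [h₁] at h₂
    have := sub_eq_zero.2 h₂
    rw [← sub_eq_zero, ← this, nsmul_sub]
    module
  -- If `π j ≠ j`, pick a third index `k` outside `{j, π j}`, which exists since `n ≥ 3`. The
  -- relation between the columns `j` and `k` then contradicts independence.
  have hdiag : ∀ j, π j = j := by
    by_contra! hcon
    obtain ⟨j, hj⟩ := hcon
    obtain ⟨k, hkj, hkπ⟩ : ∃ k, k ≠ j ∧ k ≠ π j := by
      by_contra! h
      have h1 : (Finset.univ : Finset (Fin n)) ⊆ {j, π j} := by
        intro k _
        by_cases hk : k = j
        · simp [hk]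
        · simp [h k hk]
      have h2 := (Finset.card_le_card h1).trans Finset.card_le_two
      rw [Finset.card_univ, Fintype.card_fin] at h2
      omega
    rcases hkey _ _ _ _ (hπ j) (hπ k) with h | h | h
    · exact hkπ h.1.symm
    · exact hj h.1
    · exact hkj h.2
  have hoff : ∀ i j, i ≠ j → coeffHom b c 0 (G i j) = 0 := by
    intro i j hij
    by_contra h
    obtain ⟨k, hk⟩ : ∃ k, k ≠ j := ⟨i, hij⟩
    rcases hkey _ _ _ _ h (hπ k) with h' | h' | h'
    · rw [hdiag] at h'; exact hk h'.2.symm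
    · exact hij h'.1
    · exact hk h'.2
  refine ⟨hint, hoff, fun j => ?_⟩
  rw [← hsum j, Finset.sum_eq_single j]
  · intro i _ hij
    rw [hoff i j hij, mul_zero]
  · simp

/-- For an integral matrix, taking constant terms commutes with the determinant, and the residue
matrix is diagonal. -/
theorem prod_nrd_coeffHom_zero
    {G : Matrix (Fin n) (Fin n) ℍ[HahnSeries Γ F,(C b : HahnSeries Γ F),(C c : HahnSeries Γ F)]}
    (hint : ∀ i j, ∀ γ < 0, coeffHom b c γ (G i j) = 0)
    (hoff : ∀ i j, i ≠ j → coeffHom b c 0 (G i j) = 0)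
    {M : Type*} [Field M] (f : F →+* M) {s : M} (hs : s ^ 2 = f b)
    (hs₀ : C s ^ 2 = mapRingHom Γ f (C b)) {x : HahnSeries Γ F}
    (hdet : detRep (mapRingHom Γ f) hs₀ G = mapRingHom Γ f x) :
    ∏ j, nrd (coeffHom b c 0 (G j j)) = x.coeff 0 := by
  have hentry : ∀ i j, coeffHom b c 0 (G i j) =
      (Matrix.diagonal (fun j => coeffHom b c 0 (G j j)) : Matrix _ _ ℍ[F,b,c]) i j := by
    intro i j
    by_cases hij : i = j
    · subst hij; simp
    · rw [Matrix.diagonal_apply_ne _ hij, hoff i j hij]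
  have hmem : ∀ i j, (G i j).re ∈ integers Γ F ∧ (G i j).imI ∈ integers Γ F ∧
      (G i j).imJ ∈ integers Γ F ∧ (G i j).imK ∈ integers Γ F := fun i j =>
    forall_coeffHom_eq_zero_iff.1 (hint i j)
  have hf₀int : ∀ x ∈ integers Γ F, mapRingHom Γ f x ∈ integers Γ M := by
    intro x hx γ hγ
    rw [coeff_mapRingHom, hx γ hγ, map_zero]
  have hCint : ∀ x : M, C x ∈ integers Γ M := by
    intro x γ hγ
    rw [C_apply, coeff_single_of_ne hγ.ne]
  have hρint : ∀ i j, matRep (Fin n) (C c) (mapRingHom Γ f) hs₀ G i j ∈ integers Γ M := by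
    rintro ⟨i, a⟩ ⟨j, a'⟩
    obtain ⟨h0, h1, h2, h3⟩ := hmem i j
    have hfc : mapRingHom Γ f (C c) ∈ integers Γ M := by
      rw [mapRingHom_C]; exact hCint _
    rw [matRep_apply]
    fin_cases a <;> fin_cases a'
    · exact add_mem (hf₀int _ h0) (mul_mem (hCint s) (hf₀int _ h1))
    · exact mul_mem hfc (add_mem (hf₀int _ h2) (mul_mem (hCint s) (hf₀int _ h3)))
    · exact sub_mem (hf₀int _ h2) (mul_mem (hCint s) (hf₀int _ h3))
    · exact sub_mem (hf₀int _ h0) (mul_mem (hCint s) (hf₀int _ h1))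
  have hres : (matRep (Fin n) (C c) (mapRingHom Γ f) hs₀ G).map (fun x => x.coeff 0)
      = matRep (Fin n) c f hs (Matrix.diagonal fun j => coeffHom b c 0 (G j j)) := by
    ext ⟨i, a⟩ ⟨j, a'⟩
    rw [Matrix.map_apply, matRep_apply, matRep_apply, ← hentry]
    have hfc : mapRingHom Γ f (single 0 c) = single 0 (f c) := mapRingHom_C f c
    fin_cases a <;> fin_cases a' <;>
      simp [splitRep, hfc, mul_add, coeffHom, coeff_mapRingHom]
    ring
  have h1 := coeff_zero_det _ hρint
  rw [hres] at h1
  change (detRep (mapRingHom Γ f) hs₀ G).coeff 0 = detRep f hs _ at h1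
  rw [hdet, detRep_diagonal, coeff_mapRingHom, ← map_prod] at h1
  exact (f.injective h1).symm

/-- The matrix `t ^ (eᵢ - eⱼ - w) θ(gᵢⱼ)` where `θ` doubles the exponents. -/
def rescale (e : Fin n → Γ) (w : Γ)
    (g : Matrix (Fin n) (Fin n) ℍ[HahnSeries Γ F,(C b : HahnSeries Γ F),(C c : HahnSeries Γ F)]) :
    Matrix (Fin n) (Fin n) ℍ[HahnSeries Γ F,(C b : HahnSeries Γ F),(C c : HahnSeries Γ F)] :=
  Matrix.of fun i j => (single (e i - e j - w) (1 : F) : HahnSeries Γ F) •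
    mapHom (doubling Γ F) (doubling_C b) (doubling_C c) (g i j)

theorem exists_of_coeffHom_rescale_ne_zero {e : Fin n → Γ} {w : Γ}
    {g : Matrix (Fin n) (Fin n) ℍ[HahnSeries Γ F,(C b : HahnSeries Γ F),(C c : HahnSeries Γ F)]}
    {i j : Fin n} {γ : Γ} (h : coeffHom b c γ (rescale e w g i j) ≠ 0) :
    ∃ δ, γ = e i - e j - w + 2 • δ := by
  rw [rescale, Matrix.of_apply, coeffHom_single_smul, Ne, coeffHom_eq_zero_iff] at h
  obtain ⟨δ, hδ⟩ : ∃ δ, γ - (e i - e j - w) = 2 • δ := by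
    by_contra hcon
    refine h ⟨?_, ?_, ?_, ?_⟩ <;>
    · by_contra h'
      exact hcon (exists_of_coeff_doubling_ne_zero h')
  exact ⟨δ, by rw [← hδ]; abel⟩

theorem mapHom_doubling_constHom (x : ℍ[F,b,c]) :
    mapHom (doubling Γ F) (doubling_C b) (doubling_C c) (constHom Γ b c x) = constHom Γ b c x :=
  QuaternionAlgebra.ext (doubling_C _) (doubling_C _) (doubling_C _) (doubling_C _)

theorem mapHom_smul {R S : Type*} [CommRing R] [CommRing S] {b c : R} {b' c' : S} (f : R →+* S)
    (hb : f b = b') (hc : f c = c') (r : R) (x : ℍ[R,b,c]) :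
    mapHom f hb hc (r • x) = f r • mapHom f hb hc x := by
  rw [Algebra.smul_def, map_mul, mapHom_algebraMap, ← Algebra.smul_def]

/-- After doubling, the form has entries `t^(2eᵢ)qᵢ`; the factors `t^(eᵢ - eⱼ - w)` absorb these
squares. -/
theorem sum_rescale {e : Fin n → Γ} {q : Fin n → ℍ[F,b,c]} {μ : HahnSeries Γ F}
    {g : Matrix (Fin n) (Fin n) ℍ[HahnSeries Γ F,(C b : HahnSeries Γ F),(C c : HahnSeries Γ F)]}
    {j : Fin n} (hg : ∑ i, star (g i j) * ((single (e i) (1 : F) : HahnSeries Γ F) •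
      constHom Γ b c (q i)) * g i j
      = μ • (single (e j) (1 : F) : HahnSeries Γ F) • constHom Γ b c (q j)) (w : Γ) :
    ∑ i, star (rescale e w g i j) * constHom Γ b c (q i) * rescale e w g i j
      = (single (-(2 • w)) (1 : F) * doubling Γ F μ) • constHom Γ b c (q j) := by
  have h1 := congr_arg (mapHom (doubling Γ F) (doubling_C b) (doubling_C c)) hg
  rw [map_sum, mapHom_smul, mapHom_smul, mapHom_doubling_constHom, doubling_single] at h1
  have h2 : single (-(2 • w)) (1 : F) * doubling Γ F μ
      = single (-(2 • w) - 2 • e j) 1 * (doubling Γ F μ * single (2 • e j) 1) := by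
    rw [mul_comm (doubling Γ F μ), ← mul_assoc, single_mul_single, mul_one, sub_add_cancel]
  rw [h2, mul_smul, mul_smul, ← h1, Finset.smul_sum]
  refine Finset.sum_congr rfl fun i _ => ?_
  rw [map_mul, map_mul, mapHom_smul, mapHom_doubling_constHom, ← star_mapHom, doubling_single,
    rescale, Matrix.of_apply, star_smul']
  simp only [smul_mul_assoc, mul_smul_comm, smul_smul, single_mul_single, mul_one]
  congr 3
  module

/-- The determinant changes by the `n`-th power of the factor `t^(-2w)` by which the multiplier
changes, so being improper is preserved. -/
theorem detRep_rescale {e : Fin n → Γ} {w : Γ}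
    {g : Matrix (Fin n) (Fin n) ℍ[HahnSeries Γ F,(C b : HahnSeries Γ F),(C c : HahnSeries Γ F)]}
    {S : Type*} [CommRing S] (f : HahnSeries Γ F →+* S) {s : S} (hs : s ^ 2 = f (C b))
    (hs' : s ^ 2 = (f.comp (doubling Γ F)) (C b)) :
    detRep f hs (rescale e w g)
      = f (single (-(2 • w)) 1) ^ n * detRep (f.comp (doubling Γ F)) hs' g := by
  -- The shift `eᵢ - eⱼ - w` splits into a row factor and a column factor; for each index the
  -- squares of the two multiply to `t^(-2w)`.
  have hfac : rescale e w g = Matrix.diagonal (fun i => algebraMap (HahnSeries Γ F) _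
        (single (e i) 1)) * g.map (mapHom (doubling Γ F) (doubling_C b) (doubling_C c))
        * Matrix.diagonal (fun j => algebraMap (HahnSeries Γ F) _ (single (-e j - w) 1)) := by
    ext1 i j
    rw [Matrix.mul_diagonal, Matrix.diagonal_mul, Matrix.map_apply, ← Algebra.commutes,
      ← mul_assoc, ← map_mul, single_mul_single, ← Algebra.smul_def, mul_one, rescale,
      Matrix.of_apply]
    congr 2
    abel_nf
  have hn0 : ∀ x : HahnSeries Γ F, nrd (algebraMap (HahnSeries Γ F)
      ℍ[HahnSeries Γ F,(C b : HahnSeries Γ F),(C c : HahnSeries Γ F)] x) = x ^ 2 := by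
    intro x; simp [nrd, QuaternionAlgebra.algebraMap_eq]
  rw [hfac, detRep_mul, detRep_mul, detRep_diagonal, detRep_diagonal,
    detRep_map (doubling Γ F) (doubling_C b) (doubling_C c) f hs hs', mul_right_comm,
    ← Finset.prod_mul_distrib]
  congr 1
  rw [Finset.prod_congr rfl (g := fun _ => f (single (-(2 • w)) 1)), Finset.prod_const,
    Finset.card_univ, Fintype.card_fin]
  intro i _
  rw [hn0, hn0, ← map_mul, ← mul_pow, single_mul_single, single_pow, mul_one, one_pow]
  congr 3
  abel

theorem exists_residue_of_similitude (hn : 3 ≤ n) (hdiv : IsQuatDivision b c) {e : Fin n → Γ}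
    {q : Fin n → ℍ[F,b,c]} (hq : ∀ i, q i ≠ 0)
    (he : ∀ i j k l, (∃ δ, e i + e j - e k - e l = 2 • δ) →
      (i = j ∧ k = l) ∨ (i = k ∧ j = l) ∨ (i = l ∧ j = k)) {μ : HahnSeries Γ F} (hμ : μ ≠ 0)
    (g : Matrix (Fin n) (Fin n) ℍ[HahnSeries Γ F,(C b : HahnSeries Γ F),(C c : HahnSeries Γ F)])
    (hg : ∀ j, ∑ i, star (g i j) * ((single (e i) (1 : F) : HahnSeries Γ F) •
      constHom Γ b c (q i)) * g i j
      = μ • (single (e j) (1 : F) : HahnSeries Γ F) • constHom Γ b c (q j))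
    {M : Type*} [Field M] (f : F →+* M) {s : M} (hs : s ^ 2 = f b)
    (hs' : C s ^ 2 = ((mapRingHom Γ f).comp (doubling Γ F)) (C b))
    (hdet : detRep ((mapRingHom Γ f).comp (doubling Γ F)) hs' g
      = ((mapRingHom Γ f).comp (doubling Γ F)) (-μ ^ n)) :
    ∃ (μ₀ : F) (u : Fin n → ℍ[F,b,c]), μ₀ ≠ 0 ∧
      (∀ j, star (u j) * q j * u j = algebraMap F _ μ₀ * q j) ∧ ∏ j, nrd (u j) = -μ₀ ^ n := by
  -- Choosing `w` as the order of `μ` moves the leading term of `θ(μ)` to exponent `0`.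
  set μ' : HahnSeries Γ F := single (-(2 • μ.order)) 1 * doubling Γ F μ with hμ'
  have hμ'coeff : ∀ γ, μ'.coeff γ = (doubling Γ F μ).coeff (γ + 2 • μ.order) := by
    intro γ
    rw [hμ', coeff_single_mul, one_mul, sub_neg_eq_add]
  have hμ'0 : μ'.coeff 0 ≠ 0 := by
    rw [hμ'coeff, zero_add, coeff_doubling]
    exact by
      rw [← leadingCoeff_eq]
      exact leadingCoeff_ne_zero.2 hμ
  have hμ'int : μ' ∈ integers Γ F := by
    intro γ hγ
    rw [hμ'coeff]
    by_contra h
    obtain ⟨δ, hδ⟩ := exists_of_coeff_doubling_ne_zero h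
    rw [hδ, coeff_doubling] at h
    have h2 : 2 • μ.order ≤ 2 • δ := nsmul_le_nsmul_right (order_le_of_coeff_ne_zero h) 2
    rw [← hδ] at h2
    exact absurd h2 (not_le.2 (by simpa using hγ))
  obtain ⟨hint, hoff, hdiag⟩ := residue_of_similitude hn hdiv hq he hμ'int hμ'0
    (rescale e μ.order g) (fun j => sum_rescale (hg j) μ.order)
    (fun _ _ _ h => exists_of_coeffHom_rescale_ne_zero h)
  refine ⟨μ'.coeff 0, _, hμ'0, hdiag, ?_⟩
  have hs₀ : (C s : HahnSeries Γ M) ^ 2 = mapRingHom Γ f (C b) := by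
    rw [← map_pow, hs, mapRingHom_C]
  rw [prod_nrd_coeffHom_zero hint hoff f hs hs₀ (x := -μ' ^ n), coeff_neg, coeff_zero_pow hμ'int]
  rw [detRep_rescale _ hs₀ hs', hdet, RingHom.comp_apply, ← map_pow, ← map_mul, map_neg, map_pow,
    hμ', mul_pow, mul_neg]

end QuaternionAlgebra
end

/-! ### The sign condition and the class of the norm of the form. -/

noncomputable section

open QuaternionAlgebra

section PureQuaternions
variable {F : Type*} [Field F] {b c : F} {q₁ q₂ q₃ : ℍ[F,b,c]} {a₁ a₂ a₃ : F}

theorem not_isSplitBy_of_sq_eq (h2 : (2 : F) ≠ 0) (hb : b ≠ 0) (hc : c ≠ 0)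
    (hdiv : IsQuatDivision b c) {d m : F} (hm : m ^ 2 = d) :
    ¬ IsSplitBy F ℍ[F,b,c] (SqrtField F d) := fun h =>
  isQuatDivision_iff.1 hdiv (isIsotropic_of_isSplitBy_sqrtField h2 hb hc h (RingHom.id F) hm)

namespace SplitCondition

theorem re_quatSeq (hs : SplitCondition q₁ q₂ q₃ a₁ a₂ a₃) (n : ℕ) (i : Fin n) :
    (quatSeq q₁ q₂ q₃ n i).re = 0 := by
  unfold quatSeq
  split_ifs
  exacts [hs.pure₁, hs.pure₂, hs.pure₃]

theorem quatSeq_ne_zero (hs : SplitCondition q₁ q₂ q₃ a₁ a₂ a₃) (n : ℕ) (i : Fin n) :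
    quatSeq a₁ a₂ a₃ n i ≠ 0 := by
  unfold quatSeq
  split_ifs
  exacts [hs.ne₁, hs.ne₂, hs.ne₃]

theorem quatSeq_sq (hs : SplitCondition q₁ q₂ q₃ a₁ a₂ a₃) (n : ℕ) (i : Fin n) :
    quatSeq q₁ q₂ q₃ n i ^ 2 = algebraMap F _ (quatSeq a₁ a₂ a₃ n i) := by
  unfold quatSeq
  split_ifs
  exacts [hs.sq₁, hs.sq₂, hs.sq₃]

theorem nrd_quatSeq (hs : SplitCondition q₁ q₂ q₃ a₁ a₂ a₃) (n : ℕ) (i : Fin n) :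
    nrd (quatSeq q₁ q₂ q₃ n i) = -quatSeq a₁ a₂ a₃ n i :=
  nrd_eq_neg_of_sq_eq (hs.re_quatSeq n i) (hs.quatSeq_sq n i)

/-- From the third entry on, the product is the square `a₃²`, and a division algebra is not split by
`F` itself. -/
theorem not_isSplitBy_quatSeq (hs : SplitCondition q₁ q₂ q₃ a₁ a₂ a₃)
    (h2 : (2 : F) ≠ 0) (hb : b ≠ 0) (hc : c ≠ 0) (hdiv : IsQuatDivision b c) (n : ℕ) (i : Fin n) :
    ¬ IsSplitBy F ℍ[F,b,c] (SqrtField F (quatSeq a₁ a₂ a₃ n i * a₃)) := by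
  by_cases h0 : i.val = 0
  · rw [show quatSeq a₁ a₂ a₃ n i = a₁ from if_pos h0]
    exact hs.not_split₁₃
  by_cases h1 : i.val = 1
  · rw [show quatSeq a₁ a₂ a₃ n i = a₂ from (if_neg h0).trans (if_pos h1)]
    exact hs.not_split₂₃
  · rw [show quatSeq a₁ a₂ a₃ n i = a₃ from (if_neg h0).trans (if_neg h1)]
    exact not_isSplitBy_of_sq_eq h2 hb hc hdiv (pow_two a₃)

/-- The local similitudes of `⟨q₁⟩, …, ⟨qₙ⟩` with a common multiplier are all proper or all
improper. -/
theorem prod_nrd_eq (hs : SplitCondition q₁ q₂ q₃ a₁ a₂ a₃)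
    (h2 : (2 : F) ≠ 0) (hb : b ≠ 0) (hc : c ≠ 0) (hdiv : IsQuatDivision b c) {n : ℕ} (hn : 3 ≤ n) (hev : Even n)
    {μ : F} (hμ : μ ≠ 0)
    {u : Fin n → ℍ[F,b,c]} (hu : ∀ j, star (u j) * quatSeq q₁ q₂ q₃ n j * u j
      = algebraMap F _ μ * quatSeq q₁ q₂ q₃ n j) : ∏ j, nrd (u j) = μ ^ n := by
  have hsign := fun j => commute_or_anticommute (hs.quatSeq_ne_zero n j) (hs.re_quatSeq n j)
    (hs.quatSeq_sq n j) hμ (hu j)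
  have hmixed : ∀ j k, (nrd (u j) = μ ∧ u j * quatSeq q₁ q₂ q₃ n j = quatSeq q₁ q₂ q₃ n j * u j) →
      (nrd (u k) = -μ ∧ quatSeq q₁ q₂ q₃ n k * u k = -(u k * quatSeq q₁ q₂ q₃ n k)) →
      IsSplitBy F ℍ[F,b,c] (SqrtField F (quatSeq a₁ a₂ a₃ n k * quatSeq a₁ a₂ a₃ n j)) := by
    intro j k hj hk
    obtain ⟨x, y, hxy⟩ := nrd_eq_of_commute h2 (hs.quatSeq_ne_zero n j) (hs.re_quatSeq n j)
      (hs.quatSeq_sq n j) hj.2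
    rw [hj.1] at hxy
    obtain ⟨w, hw⟩ := SqrtField.exists_sq (quatSeq a₁ a₂ a₃ n k * quatSeq a₁ a₂ a₃ n j)
    exact (isSplitBy_iff h2 hb hc _).2 (isIsotropic_of_anticommute h2 (hs.quatSeq_ne_zero n k)
      (hs.re_quatSeq n k) (hs.quatSeq_sq n k) hμ hk.1 hk.2 hxy _ hw)
  have h3 : quatSeq a₁ a₂ a₃ n ⟨2, hn⟩ = a₃ := by simp [quatSeq]
  have hnot := fun j => hs.not_isSplitBy_quatSeq h2 hb hc hdiv n j
  -- Every index is compared with the third, as `a₁a₂` itself gives no obstruction. If all norms are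
  -- `-μ`, evenness of `n` removes the sign.
  rcases hsign ⟨2, hn⟩ with h | h
  · have : ∀ j, nrd (u j) = μ := by
      intro j
      rcases hsign j with hj | hj
      · exact hj.1
      · exact absurd (h3 ▸ hmixed _ _ h hj) (hnot j)
    simp [this]
  · have : ∀ j, nrd (u j) = -μ := by
      intro j
      rcases hsign j with hj | hj
      · have := hmixed _ _ hj h
        rw [h3, mul_comm] at this
        exact absurd this (hnot j)
      · exact hj.1
    simp [this, hev.neg_pow]

theorem prod_nrd_quatSeq (hs : SplitCondition q₁ q₂ q₃ a₁ a₂ a₃) {n : ℕ} (hn : 3 ≤ n)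
    (hev : Even n) :
    ∃ v : F, v ≠ 0 ∧ ∏ j, nrd (quatSeq q₁ q₂ q₃ n j) = a₁ * a₂ * v ^ 2 := by
  obtain ⟨m, rfl⟩ := hev
  obtain ⟨k, rfl⟩ : ∃ k, m = k + 1 := ⟨m - 1, by omega⟩
  -- Here `n = 2k + 2`, so `q₃` occurs `2k` times.
  refine ⟨a₃ ^ k, pow_ne_zero _ hs.ne₃, ?_⟩
  rw [show k + 1 + (k + 1) = 2 * k + 2 by ring]
  simp only [hs.nrd_quatSeq, Fin.prod_univ_succ]
  simp [quatSeq, (even_two_mul k).neg_pow]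
  ring

end SplitCondition
end PureQuaternions

theorem exists_eq_mul_sq {K : Type*} [Field K] {T a v r x : K} (hT : T ≠ 0) (ha : a ≠ 0)
    (hv : v ≠ 0) (hr : r ≠ 0) (h : T ^ 2 * (a * v ^ 2) * r = x ^ 2) :
    ∃ y, y ≠ 0 ∧ r = a * y ^ 2 := by
  have hx : x ≠ 0 := by
    rintro rfl
    simp [hT, ha, hv, hr] at h
  refine ⟨x / (T * a * v), div_ne_zero hx (mul_ne_zero (mul_ne_zero hT ha) hv), ?_⟩
  rw [div_pow, ← h]
  field_simp

/-! ### The generic involution over iterated Laurent series. -/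

section GenericForm
variable {F : Type u} [Field F] {b c : F} {n : ℕ}

/-- The exponent of the indeterminate `tᵢ`. -/
def IterLaurent.exponent (n : ℕ) (i : Fin n) : Lex ((Fin n)ᵒᵈ → ℤ) :=
  toLex (Pi.single (OrderDual.toDual i) (1 : ℤ))

theorem IterLaurent.t_eq (i : Fin n) :
    IterLaurent.t F n i = HahnSeries.single (IterLaurent.exponent n i) 1 := rfl

theorem IterLaurent.t_ne_zero (i : Fin n) : IterLaurent.t F n i ≠ 0 := by
  rw [IterLaurent.t_eq]
  simp

/-- The `eᵢ` are standard basis vectors, so parities of coordinates force the four indices to pair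
off. -/
theorem IterLaurent.exponent_independent (i j k l : Fin n)
    (h : ∃ δ, exponent n i + exponent n j - exponent n k - exponent n l = 2 • δ) :
    (i = j ∧ k = l) ∨ (i = k ∧ j = l) ∨ (i = l ∧ j = k) := by
  obtain ⟨δ, hδ⟩ := h
  have key : ∀ m : Fin n, (if m = i then 1 else 0) + (if m = j then 1 else 0)
      - (if m = k then 1 else 0) - (if m = l then 1 else 0)
      = 2 * ofLex δ (OrderDual.toDual m) := by
    intro m
    have := congr_fun (congr_arg ofLex hδ) (OrderDual.toDual m)
    change (Pi.single _ (1 : ℤ) : (Fin n)ᵒᵈ → ℤ) _ + (Pi.single _ (1 : ℤ) : (Fin n)ᵒᵈ → ℤ) _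
      - (Pi.single _ (1 : ℤ) : (Fin n)ᵒᵈ → ℤ) _ - (Pi.single _ (1 : ℤ) : (Fin n)ᵒᵈ → ℤ) _
      = 2 • ofLex δ (OrderDual.toDual m) at this
    simpa [Pi.single_apply] using this
  have hi := key i
  have hj := key j
  have hk := key k
  have hl := key l
  grind

/-- The diagonal entries of the generic skew-hermitian form. -/
def genericDiag (q : Fin n → ℍ[F,b,c]) (i : Fin n) : QuatHat b c n :=
  IterLaurent.t F n i • toQuatHat n (q i)

theorem genericInvolution_eq (q : Fin n → ℍ[F,b,c]) (g : Matrix (Fin n) (Fin n) (QuatHat b c n)) :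
    genericInvolution q g = Matrix.diagonal (fun i => Ring.inverse (genericDiag q i))
      * g.conjTranspose * Matrix.diagonal (genericDiag q) := rfl

theorem nrd_toQuatHat (x : ℍ[F,b,c]) : nrd (toQuatHat n x) = HahnSeries.C (nrd x) :=
  nrd_mapHom (HahnSeries.C : F →+* IterLaurent F n) rfl rfl x

theorem nrd_genericDiag (q : Fin n → ℍ[F,b,c]) (i : Fin n) :
    nrd (genericDiag q i) = IterLaurent.t F n i ^ 2 * HahnSeries.C (nrd (q i)) := by
  rw [genericDiag, nrd_smul, nrd_toQuatHat]

theorem isUnit_genericDiag {q : Fin n → ℍ[F,b,c]} (hq : ∀ i, nrd (q i) ≠ 0) (i : Fin n) :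
    IsUnit (genericDiag q i) := by
  refine isUnit_of_nrd_ne_zero ?_
  rw [nrd_genericDiag]
  exact mul_ne_zero (pow_ne_zero _ (IterLaurent.t_ne_zero i)) (HahnSeries.C_ne_zero (hq i))

theorem diagonal_mul_genericInvolution {q : Fin n → ℍ[F,b,c]} (hq : ∀ i, nrd (q i) ≠ 0)
    (g : Matrix (Fin n) (Fin n) (QuatHat b c n)) :
    Matrix.diagonal (genericDiag q) * genericInvolution q g
      = g.conjTranspose * Matrix.diagonal (genericDiag q) := by
  rw [genericInvolution_eq, ← mul_assoc, ← mul_assoc, Matrix.diagonal_mul_diagonal]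
  simp_rw [fun i => Ring.mul_inverse_cancel _ (isUnit_genericDiag hq i)]
  rw [Matrix.diagonal_one, one_mul]

theorem star_toQuatHat_of_re_eq_zero {x : ℍ[F,b,c]} (hx : x.re = 0) :
    star (toQuatHat n x) = -toQuatHat n x := by
  ext <;> simp [toQuatHat, hx]

variable {q₁ q₂ q₃ : ℍ[F,b,c]} {a₁ a₂ a₃ : F}

theorem not_isImproperSimilitude (h2 : (2 : F) ≠ 0) (hb : b ≠ 0) (hc : c ≠ 0)
    (hdiv : IsQuatDivision b c) (hs : SplitCondition q₁ q₂ q₃ a₁ a₂ a₃) (hn : 3 ≤ n)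
    (hev : Even n) (g : Matrix (Fin n) (Fin n) (QuatHat b c n)) :
    ¬ IsImproperSimilitude (F := IterLaurent F n) n
      (genericInvolution (quatSeq q₁ q₂ q₃ n)) g := by
  rintro ⟨μ, ⟨-, hμ, hg⟩, hnrd⟩
  have : NeZero n := ⟨by omega⟩
  have hq : ∀ i, nrd (quatSeq q₁ q₂ q₃ n i) ≠ 0 := fun i => by
    rw [hs.nrd_quatSeq]
    exact neg_ne_zero.2 (hs.quatSeq_ne_zero n i)
  have hq0 : ∀ i, quatSeq q₁ q₂ q₃ n i ≠ 0 := fun i h => hq i (by rw [h, nrd_zero])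
  have h1 : g.conjTranspose * Matrix.diagonal (genericDiag (quatSeq q₁ q₂ q₃ n)) * g
      = Matrix.diagonal (genericDiag (quatSeq q₁ q₂ q₃ n)) * algebraMap (IterLaurent F n) _ μ := by
    rw [← diagonal_mul_genericInvolution hq, mul_assoc, hg]
  have h2' : ∀ j, ∑ i, star (g i j) * genericDiag (quatSeq q₁ q₂ q₃ n) i * g i j
      = μ • genericDiag (quatSeq q₁ q₂ q₃ n) j := by
    intro j
    have := congr_fun (congr_fun h1 j) j
    rw [Matrix.mul_apply, Matrix.diagonal_mul, Matrix.algebraMap_matrix_apply, if_pos rfl,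
      ← Algebra.commutes, ← Algebra.smul_def] at this
    rw [← this]
    refine Finset.sum_congr rfl fun i _ => ?_
    rw [Matrix.mul_diagonal, Matrix.conjTranspose_apply]
  obtain ⟨s, hs2⟩ := SqrtField.exists_sq b
  have hs' : (HahnSeries.C s : HahnSeries (Lex ((Fin n)ᵒᵈ → ℤ)) (SqrtField F b)) ^ 2
      = ((HahnSeries.mapRingHom (Lex ((Fin n)ᵒᵈ → ℤ)) (algebraMap F (SqrtField F b))).comp
        (HahnSeries.doubling (Lex ((Fin n)ᵒᵈ → ℤ)) F)) (HahnSeries.C b) := by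
    rw [RingHom.comp_apply, HahnSeries.doubling_C, HahnSeries.mapRingHom_C, ← hs2, map_pow]
  -- The reduced norm is computed in Hahn series over `F(√b)`, with `F̂` embedded through the
  -- doubling map; the root of `b` is a constant, so it has a residue.
  obtain ⟨μ₀, u, hμ₀, hu, hprod⟩ := exists_residue_of_similitude hn hdiv hq0
    (IterLaurent.exponent_independent (n := n)) hμ g h2' (algebraMap F (SqrtField F b)) hs2 hs'
    (detRep_eq_of_isReducedNorm hnrd _ hs')
  rw [hs.prod_nrd_eq h2 hb hc hdiv hn hev hμ₀ hu] at hprod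
  refine mul_ne_zero h2 (pow_ne_zero n hμ₀) ?_
  linear_combination hprod

theorem two_ne_zero_iterLaurent (h2 : (2 : F) ≠ 0) : (2 : IterLaurent F n) ≠ 0 := by
  rw [← map_ofNat (HahnSeries.C : F →+* IterLaurent F n) 2]
  exact HahnSeries.C_ne_zero h2

/-- Since `H` and `s` are skew for their respective involutions, `Hs` is hermitian, so `Nrd H · Nrd
s` is a square. -/
theorem exists_of_mem_involutionDiscriminant (h2 : (2 : F) ≠ 0) (hb : b ≠ 0) (hc : c ≠ 0)
    (hs : SplitCondition q₁ q₂ q₃ a₁ a₂ a₃) (hn : 3 ≤ n) (hev : Even n) {δ : IterLaurent F n}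
    (hδ : δ ∈ involutionDiscriminant n (genericInvolution (quatSeq q₁ q₂ q₃ n))) :
    ∃ u : IterLaurent F n, u ≠ 0 ∧ δ = HahnSeries.C (a₁ * a₂) * u ^ 2 := by
  obtain ⟨s, r, u, hsu, hss, hnrd, hu, rfl⟩ := hδ
  have : NeZero n := ⟨by omega⟩
  have hq : ∀ i, nrd (quatSeq q₁ q₂ q₃ n i) ≠ 0 := fun i => by
    rw [hs.nrd_quatSeq]
    exact neg_ne_zero.2 (hs.quatSeq_ne_zero n i)
  obtain ⟨v, hv, hprod⟩ := hs.prod_nrd_quatSeq hn hev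
  obtain ⟨w, hw⟩ := SqrtField.exists_sq (HahnSeries.C b : IterLaurent F n)
  set f := algebraMap (IterLaurent F n) (SqrtField (IterLaurent F n) (HahnSeries.C b)) with hf
  have hr := detRep_eq_of_isReducedNorm hnrd f hw
  have hr0 : r ≠ 0 := by
    rintro rfl
    obtain ⟨s', hs', -⟩ := isUnit_iff_exists.1 hsu
    have := detRep_mul f hw s s'
    rw [hs', hr, map_zero, zero_mul, detRep, map_one, Matrix.det_one] at this
    exact one_ne_zero this
  obtain ⟨x, hx⟩ := exists_detRep_eq_sq hw (two_ne_zero_iterLaurent h2) (HahnSeries.C_ne_zero hb)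
    (HahnSeries.C_ne_zero hc) (Matrix.diagonal (genericDiag (quatSeq q₁ q₂ q₃ n)) * s) (by
      have h1 := diagonal_mul_genericInvolution hq s
      rw [hss] at h1
      have h3 : star (genericDiag (quatSeq q₁ q₂ q₃ n))
          = fun i => -genericDiag (quatSeq q₁ q₂ q₃ n) i := by
        ext1 i
        rw [Pi.star_apply, genericDiag, star_smul',
          star_toQuatHat_of_re_eq_zero (hs.re_quatSeq n i), smul_neg]
      rw [Matrix.conjTranspose_mul, Matrix.diagonal_conjTranspose, h3, ← Matrix.diagonal_neg,
        mul_neg, ← h1, mul_neg, neg_neg])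
  rw [detRep_mul, detRep_diagonal, hr, ← map_prod, ← map_mul, ← map_pow] at hx
  have hx' := f.injective hx
  simp only [nrd_genericDiag] at hx'
  rw [Finset.prod_mul_distrib, Finset.prod_pow, ← map_prod, hprod, map_mul _ (a₁ * a₂),
    map_pow] at hx'
  obtain ⟨y, hy0, hy⟩ := exists_eq_mul_sq
    (Finset.prod_ne_zero_iff.2 fun i _ => IterLaurent.t_ne_zero (F := F) (n := n) i)
    (HahnSeries.C_ne_zero (mul_ne_zero hs.ne₁ hs.ne₂)) (HahnSeries.C_ne_zero hv) hr0 hx'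
  refine ⟨y * u, mul_ne_zero hy0 hu, ?_⟩
  rw [hev.neg_one_pow, one_mul, hy, mul_pow, mul_assoc]

theorem mem_involutionDiscriminant (h2 : (2 : F) ≠ 0) (hb : b ≠ 0) (hc : c ≠ 0)
    (hs : SplitCondition q₁ q₂ q₃ a₁ a₂ a₃) (hn : 3 ≤ n) (hev : Even n) {u : IterLaurent F n}
    (hu : u ≠ 0) : HahnSeries.C (a₁ * a₂) * u ^ 2 ∈
      involutionDiscriminant n (genericInvolution (quatSeq q₁ q₂ q₃ n)) := by
  have hq : ∀ i, nrd (quatSeq q₁ q₂ q₃ n i) ≠ 0 := fun i => by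
    rw [hs.nrd_quatSeq]
    exact neg_ne_zero.2 (hs.quatSeq_ne_zero n i)
  obtain ⟨v, hv, hprod⟩ := hs.prod_nrd_quatSeq hn hev
  have hv' : (HahnSeries.C v : IterLaurent F n) ≠ 0 := HahnSeries.C_ne_zero hv
  obtain ⟨w, hw⟩ := SqrtField.exists_sq (HahnSeries.C b : IterLaurent F n)
  -- The matrix `diag(qᵢ)` is skew because each `qᵢ` is pure and commutes with `tᵢqᵢ`. Its reduced
  -- norm is `a₁a₂v²`, and dividing `u` by `v` corrects the square.
  refine ⟨Matrix.diagonal fun i => toQuatHat n (quatSeq q₁ q₂ q₃ n i),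
    HahnSeries.C (a₁ * a₂ * v ^ 2), u / HahnSeries.C v, ?_, ?_, ?_,
    div_ne_zero hu hv', ?_⟩
  · refine (Pi.isUnit_iff.2 fun i => isUnit_of_nrd_ne_zero ?_ :
      IsUnit fun i => toQuatHat n (quatSeq q₁ q₂ q₃ n i)).map (Matrix.diagonalRingHom (Fin n) _)
    rw [nrd_toQuatHat]
    exact HahnSeries.C_ne_zero (hq i)
  · rw [genericInvolution_eq, Matrix.diagonal_conjTranspose, Matrix.diagonal_mul_diagonal,
      Matrix.diagonal_mul_diagonal, Matrix.diagonal_neg]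
    congr 1
    ext1 i
    have h1 : toQuatHat n (quatSeq q₁ q₂ q₃ n i) * genericDiag (quatSeq q₁ q₂ q₃ n) i
        = genericDiag (quatSeq q₁ q₂ q₃ n) i * toQuatHat n (quatSeq q₁ q₂ q₃ n i) := by
      rw [genericDiag, mul_smul_comm, smul_mul_assoc]
    rw [Pi.star_apply, star_toQuatHat_of_re_eq_zero (hs.re_quatSeq n i), mul_neg,
      neg_mul, mul_assoc, h1, ← mul_assoc, Ring.inverse_mul_cancel _ (isUnit_genericDiag hq i),
      one_mul]
  · refine isReducedNorm_of_detRep (two_ne_zero_iterLaurent h2) (HahnSeries.C_ne_zero hb)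
      (HahnSeries.C_ne_zero hc) hw ?_
    rw [detRep_diagonal, ← map_prod]
    simp only [nrd_toQuatHat]
    rw [← map_prod, hprod]
  · rw [hev.neg_one_pow, one_mul, div_pow, map_mul _ (a₁ * a₂), map_pow, mul_assoc,
      mul_div_cancel₀ _ (pow_ne_zero 2 hv')]

/-- Leading coefficients are multiplicative, so a square root in `F̂` would give one of `a₁a₂` in
`F`, and `Q` would already be split over `F`. -/
theorem not_isSquare_discriminant (h2 : (2 : F) ≠ 0) (hb : b ≠ 0) (hc : c ≠ 0)
    (hdiv : IsQuatDivision b c) (hs : SplitCondition q₁ q₂ q₃ a₁ a₂ a₃) {u : IterLaurent F n}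
    (hu : u ≠ 0) : ¬ IsSquare (HahnSeries.C (a₁ * a₂) * u ^ 2) := by
  rintro ⟨x, hx⟩
  have h1 := congr_arg HahnSeries.leadingCoeff hx
  rw [pow_two, HahnSeries.leadingCoeff_mul, HahnSeries.leadingCoeff_mul,
    HahnSeries.leadingCoeff_mul, HahnSeries.C_apply, HahnSeries.leadingCoeff_of_single] at h1
  have hu' : u.leadingCoeff ≠ 0 := HahnSeries.leadingCoeff_ne_zero.2 hu
  refine not_isSplitBy_of_sq_eq h2 hb hc hdiv (m := x.leadingCoeff / u.leadingCoeff) ?_ hs.split₁₂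
  rw [div_pow, pow_two, ← h1]
  field_simp

/-- `Z` contains the square root `w / u` of `a₁a₂`, so the splitting over `F(√(a₁a₂))` carries over.
-/
theorem isSplitBy_discriminant (h2 : (2 : F) ≠ 0) (hb : b ≠ 0) (hc : c ≠ 0)
    (hs : SplitCondition q₁ q₂ q₃ a₁ a₂ a₃) {u δ : IterLaurent F n} (hu : u ≠ 0)
    (hδ : δ = HahnSeries.C (a₁ * a₂) * u ^ 2) :
    IsSplitBy (IterLaurent F n) (QuatHat b c n) (SqrtField (IterLaurent F n) δ) := by
  rw [isSplitBy_iff (two_ne_zero_iterLaurent h2) (HahnSeries.C_ne_zero hb)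
    (HahnSeries.C_ne_zero hc)]
  obtain ⟨w, hw⟩ := SqrtField.exists_sq δ
  let f := algebraMap (IterLaurent F n) (SqrtField (IterLaurent F n) δ)
  refine isIsotropic_of_isSplitBy_sqrtField h2 hb hc hs.split₁₂ (f.comp HahnSeries.C)
    (m := w / f u) ?_
  have hw' : w ^ 2 = f (HahnSeries.C (a₁ * a₂)) * f u ^ 2 := by
    rw [hw, ← map_pow, ← map_mul, ← hδ]
  rw [div_pow, hw', mul_div_cancel_right₀ _ (pow_ne_zero 2 ((map_ne_zero f).2 hu))]
  rfl

end GenericForm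
end

/-! ### Descent of isotropy to the constants, and change of variable. -/

noncomputable section

open QuaternionAlgebra MvPolynomial

section Descent

theorem QuaternionAlgebra.IsIsotropic.of_isFractionRing {R K : Type*} [CommRing R] [IsDomain R]
    [Field K]
    [Algebra R K] [IsFractionRing R K] {b c : R}
    (h : IsIsotropic (algebraMap R K b) (algebraMap R K c)) : IsIsotropic b c := by
  obtain ⟨x, hx, hx0⟩ := h
  obtain ⟨⟨d, hd⟩, hdx⟩ := IsLocalization.exist_integer_multiples_of_finite (nonZeroDivisors R)
    ![x.re, x.imI, x.imJ, x.imK]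
  have hd0 : algebraMap R K d ≠ 0 :=
    IsFractionRing.to_map_ne_zero_of_mem_nonZeroDivisors hd
  choose y hy using hdx
  have hxy : mapHom (algebraMap R K) rfl rfl (⟨y 0, y 1, y 2, y 3⟩ : ℍ[R,b,c])
      = algebraMap R K d • x := by
    ext
    · simpa [Algebra.smul_def] using hy 0
    · simpa [Algebra.smul_def] using hy 1
    · simpa [Algebra.smul_def] using hy 2
    · simpa [Algebra.smul_def] using hy 3
  refine ⟨⟨y 0, y 1, y 2, y 3⟩, ?_, IsFractionRing.injective R K ?_⟩
  · intro h
    rw [h, map_zero] at hxy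
    exact hx ((smul_eq_zero.1 hxy.symm).resolve_left hd0)
  · rw [← nrd_mapHom _ rfl rfl, hxy, nrd_smul, hx0, mul_zero, map_zero]

/-- Let `D` be the largest leading exponent among the coordinates. The coefficient of the norm at
`2D` is the norm of the coefficients at `D`, which are not all zero. -/
theorem QuaternionAlgebra.IsIsotropic.of_mvPolynomial {σ k : Type*} [Field k]
    (m : MonomialOrder σ) {b c : k}
    (h : IsIsotropic (C b : MvPolynomial σ k) (C c)) : IsIsotropic b c := by
  obtain ⟨x, hx, hx0⟩ := h
  let S : Set (MvPolynomial σ k) := {x.re, x.imI, x.imJ, x.imK}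
  have hS : (S \ {0}).Nonempty := by
    by_contra! hS
    simp only [S, Set.sdiff_eq_empty, Set.insert_subset_iff, Set.singleton_subset_iff,
      Set.mem_singleton_iff] at hS
    exact hx (QuaternionAlgebra.ext hS.1 hS.2.1 hS.2.2.1 hS.2.2.2)
  obtain ⟨p, ⟨hp, hp0⟩, hmax⟩ := Set.exists_max_image (S \ {0})
    (fun p => m.toSyn (m.degree p)) ((by simp [S] : S.Finite).sdiff) hS
  set D := m.degree p with hD
  have hle : ∀ q ∈ S, m.toSyn (m.degree q) ≤ m.toSyn D := by
    intro q hq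
    by_cases h : q = 0
    · simp [h]
    · exact hmax q ⟨hq, h⟩
  have hsq : ∀ q : MvPolynomial σ k, m.toSyn (m.degree q) ≤ m.toSyn D →
      (q ^ 2).coeff (D + D) = q.coeff D ^ 2 := fun q hq => by
    rw [pow_two, m.coeff_mul_of_add_of_degree_le hq hq, pow_two]
  refine ⟨⟨x.re.coeff D, x.imI.coeff D, x.imJ.coeff D, x.imK.coeff D⟩, ?_, ?_⟩
  · intro h
    simp only [QuaternionAlgebra.ext_iff, re_zero, imI_zero, imJ_zero, imK_zero] at h
    refine (m.coeff_degree_ne_zero_iff (f := p)).2 hp0 ?_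
    simp only [S, Set.mem_insert_iff, Set.mem_singleton_iff] at hp
    rcases hp with rfl | rfl | rfl | rfl
    exacts [h.1, h.2.1, h.2.2.1, h.2.2.2]
  · have := congr_arg (coeff (D + D)) hx0
    rw [nrd, ← C_mul, coeff_add, coeff_sub, coeff_sub, coeff_C_mul, coeff_C_mul, coeff_C_mul,
      hsq _ (hle _ (by simp [S])), hsq _ (hle _ (by simp [S])), hsq _ (hle _ (by simp [S])),
      hsq _ (hle _ (by simp [S])), coeff_zero] at this
    exact this

end Descent

section Substitution

/-- Completing the square, `(xᵢ + ay)² = c + (ay)²`: if `y` were algebraic over the other variables,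
so would be `xᵢ`. -/
theorem AlgebraicIndependent.update_of_mul_add_sq {ι k K : Type*} [Field k] [Field K]
    [Algebra k K] [DecidableEq ι] {x : ι → K} (hx : AlgebraicIndependent k x) (i : ι) {y a c : K}
    (ha : a ∈ Algebra.adjoin k (x '' {i}ᶜ)) (hc : c ∈ Algebra.adjoin k (x '' {i}ᶜ))
    (h : x i ^ 2 + 2 * a * y * x i = c) : AlgebraicIndependent k (Function.update x i y) := by
  have himage : Function.update x i y '' {i}ᶜ = x '' {i}ᶜ :=
    Set.image_congr fun j hj => Function.update_of_ne hj _ _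
  rw [AlgebraicIndependent.iff_transcendental_adjoin_image i] at hx ⊢
  rw [himage, Function.update_self]
  refine ⟨?_, fun hy => hx.2 ?_⟩
  · convert hx.1 using 2 with j
    exact Function.update_of_ne j.2 _ _
  · set B := Algebra.adjoin k (x '' {i}ᶜ)
    have ha' : IsAlgebraic B a := isAlgebraic_algebraMap (⟨a, ha⟩ : B)
    have hc' : IsAlgebraic B c := isAlgebraic_algebraMap (⟨c, hc⟩ : B)
    have h1 : IsAlgebraic B ((x i + a * y) ^ 2) := by
      rw [show (x i + a * y) ^ 2 = c + (a * y) ^ 2 by rw [← h]; ring]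
      exact hc'.add ((ha'.mul hy).pow 2)
    have h2 := (h1.of_pow two_pos).sub (ha'.mul hy)
    rwa [add_sub_cancel_right] at h2

end Substitution
end

/-! ### The example over `k(r, s, t)`. -/

noncomputable section

open QuaternionAlgebra MvPolynomial

namespace RatFunc3
variable (k : Type*) [Field k]

theorem algebraicIndependent_ind : AlgebraicIndependent k (ind k) :=
  (algebraicIndependent_X (Fin 3) k).map' (f := IsScalarTower.toAlgHom k _ (RatFunc3 k))
    (IsFractionRing.injective _ _)

theorem ind_ne_zero (i : Fin 3) : ind k i ≠ 0 := (algebraicIndependent_ind k).ne_zero i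

variable {k}

theorem two_ne_zero (h2 : (2 : k) ≠ 0) : (2 : RatFunc3 k) ≠ 0 := by
  rw [← map_ofNat (algebraMap k (RatFunc3 k)) 2]
  exact (map_ne_zero _).2 h2

theorem isQuatDivision {b c : k} (h : IsQuatDivision b c) :
    IsQuatDivision (algebraMap k (RatFunc3 k) b) (algebraMap k (RatFunc3 k) c) := by
  rw [isQuatDivision_iff] at h ⊢
  rw [IsScalarTower.algebraMap_apply k (MvPolynomial (Fin 3) k) (RatFunc3 k) b,
    IsScalarTower.algebraMap_apply k (MvPolynomial (Fin 3) k) (RatFunc3 k) c]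
  exact fun hiso => h (.of_mvPolynomial MonomialOrder.lex (.of_isFractionRing hiso))

/-- The function field of the quadric `m² = a (a xᵢ² + e)` is again rational. -/
theorem exists_algHom_sq (h2 : (2 : k) ≠ 0) (i : Fin 3) {a : k} (ha : a ≠ 0) {e : RatFunc3 k}
    (he : e ∈ Algebra.adjoin k (ind k '' {i}ᶜ)) :
    ∃ (f : RatFunc3 k →ₐ[k] RatFunc3 k) (m : RatFunc3 k),
      m ^ 2 = f (algebraMap k _ a * (algebraMap k _ a * ind k i ^ 2 + e)) := by
  have h2' := two_ne_zero h2
  have ha' : algebraMap k (RatFunc3 k) a ≠ 0 := (map_ne_zero _).2 ha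
  have hi := ind_ne_zero k i
  set A := algebraMap k (RatFunc3 k) a
  have hA : A ∈ Algebra.adjoin k (ind k '' {i}ᶜ) := Subalgebra.algebraMap_mem _ a
  -- Solve `m² - A²y² = Ae` by `m - Ay = xᵢ` and `m + Ay = Ae / xᵢ`; the endomorphism sends `xᵢ` to
  -- `y` and fixes the other variables.
  have hy := (algebraicIndependent_ind k).update_of_mul_add_sq i
    (y := (A * e / ind k i - ind k i) / (2 * A)) hA (mul_mem hA he) (by field_simp; ring)
  refine ⟨IsFractionRing.liftAlgHom (g := aeval _) hy, (A * e / ind k i + ind k i) / 2, ?_⟩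
  set f : RatFunc3 k →ₐ[k] RatFunc3 k := IsFractionRing.liftAlgHom (g := aeval _) hy with hf
  have hfX : ∀ j, f (ind k j)
      = Function.update (ind k) i ((A * e / ind k i - ind k i) / (2 * A)) j := fun j => by
    refine (IsFractionRing.lift_algebraMap (K := RatFunc3 k) hy (X j)).trans ?_
    exact aeval_X _ j
  have hfe : f e = e := by
    have : Algebra.adjoin k (ind k '' {i}ᶜ) ≤ AlgHom.equalizer f (AlgHom.id k _) := by
      rw [Algebra.adjoin_le_iff]
      rintro _ ⟨j, hj, rfl⟩
      rw [SetLike.mem_coe, AlgHom.mem_equalizer, hfX, Function.update_of_ne hj]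
      rfl
    exact this he
  have hfA : f A = A := f.commutes a
  rw [map_mul, map_add, map_mul, map_pow, hfX, Function.update_self, hfA, hfe]
  field_simp
  ring

/-- The endomorphism fixes `b` and `c` and makes the radicand a square, so a splitting would make
`(b, c)` isotropic over `k(r,s,t)` itself. -/
theorem not_isSplitBy (h2 : (2 : k) ≠ 0) {b c : k} (hb : b ≠ 0) (hc : c ≠ 0)
    (h : IsQuatDivision b c) (i : Fin 3) {a : k} (ha : a ≠ 0) {e : RatFunc3 k}
    (he : e ∈ Algebra.adjoin k (ind k '' {i}ᶜ)) :
    ¬ IsSplitBy (RatFunc3 k)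
      ℍ[RatFunc3 k, algebraMap k (RatFunc3 k) b, algebraMap k (RatFunc3 k) c]
      (SqrtField (RatFunc3 k) (algebraMap k _ a * (algebraMap k _ a * ind k i ^ 2 + e))) := by
  intro hs
  obtain ⟨f, m, hm⟩ := exists_algHom_sq h2 i ha he
  have := isIsotropic_of_isSplitBy_sqrtField (two_ne_zero h2) ((map_ne_zero _).2 hb)
    ((map_ne_zero _).2 hc) hs f.toRingHom hm
  have hb' : f.toRingHom (algebraMap k (RatFunc3 k) b) = algebraMap k (RatFunc3 k) b := f.commutes b
  have hc' : f.toRingHom (algebraMap k (RatFunc3 k) c) = algebraMap k (RatFunc3 k) c := f.commutes c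
  rw [hb', hc'] at this
  exact isQuatDivision_iff.1 (isQuatDivision h) this

theorem exists_splitCondition (h2 : (2 : k) ≠ 0) (hneg : IsSquare (-1 : k)) {a₁ a₂ : k}
    (ha₁ : a₁ ≠ 0) (ha₂ : a₂ ≠ 0) (h : IsQuatDivision a₁ a₂) {A₁ A₂ a₃ : RatFunc3 k}
    (hA₁ : A₁ = algebraMap k (RatFunc3 k) a₁) (hA₂ : A₂ = algebraMap k (RatFunc3 k) a₂)
    (ha₃ : a₃ = A₁ * ind k 0 ^ 2 + A₂ * ind k 1 ^ 2 + A₁ * A₂ * ind k 2 ^ 2) :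
    ∃ q₁ q₂ q₃ : ℍ[RatFunc3 k, A₁, A₂], SplitCondition q₁ q₂ q₃ A₁ A₂ a₃ := by
  obtain ⟨ε, hε⟩ := hneg
  set E := algebraMap k (RatFunc3 k) ε
  have hE : E ^ 2 = -1 := by rw [pow_two, ← map_mul, ← hε, map_neg, map_one]
  have hA₁0 : A₁ ≠ 0 := by rw [hA₁]; exact (map_ne_zero _).2 ha₁
  have hA₂0 : A₂ ≠ 0 := by rw [hA₂]; exact (map_ne_zero _).2 ha₂
  have hdiv : ¬ IsIsotropic A₁ A₂ := by
    rw [hA₁, hA₂, ← isQuatDivision_iff]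
    exact isQuatDivision h
  -- Since `(ij)² = -A₁A₂`, the factor `E = √-1` corrects the sign of the last term of `a₃`.
  let q₃ : ℍ[RatFunc3 k, A₁, A₂] := ⟨0, ind k 0, ind k 1, E * ind k 2⟩
  have hq₃ : nrd q₃ = -a₃ := by
    simp only [nrd, q₃, ha₃]
    linear_combination A₁ * A₂ * ind k 2 ^ 2 * hE
  have hmem : ∀ i j, j ≠ i → ind k j ∈ Algebra.adjoin k (ind k '' {i}ᶜ) := fun i j hij =>
    Algebra.subset_adjoin ⟨j, hij, rfl⟩
  have hmemA : ∀ (i : Fin 3) (a : k), algebraMap k (RatFunc3 k) a ∈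
      Algebra.adjoin k (ind k '' {i}ᶜ) := fun i a => Subalgebra.algebraMap_mem _ a
  refine ⟨⟨0, 1, 0, 0⟩, ⟨0, 0, 1, 0⟩, q₃, rfl, rfl, rfl, hA₁0, hA₂0, ?_, ?_, ?_, ?_, ?_, ?_, ?_⟩
  · rw [← neg_ne_zero, ← hq₃]
    intro h0
    refine hdiv ⟨q₃, fun h => ind_ne_zero k 0 (congr_arg QuaternionAlgebra.imI h), h0⟩
  · rw [sq_eq_of_re_eq_zero rfl]
    simp [nrd]
  · rw [sq_eq_of_re_eq_zero rfl]
    simp [nrd]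
  · rw [sq_eq_of_re_eq_zero rfl, hq₃, neg_neg]
  · rw [isSplitBy_iff (two_ne_zero h2) hA₁0 hA₂0]
    obtain ⟨w, hw⟩ := SqrtField.exists_sq (A₁ * A₂)
    -- The norm of `w + E·ij` is `w² + A₁A₂E² = w² - A₁A₂ = 0`.
    refine ⟨⟨w, 0, 0, algebraMap _ _ E⟩, fun h => ?_, ?_⟩
    · have hE0 : E ≠ 0 := by
        rintro h
        rw [h] at hE
        simp at hE
      exact hE0 ((map_eq_zero _).1 (congr_arg QuaternionAlgebra.imK h))
    · simp only [nrd]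
      have hE' : (algebraMap _ (SqrtField (RatFunc3 k) (A₁ * A₂)) E) ^ 2 = -1 := by
        rw [← map_pow, hE, map_neg, map_one]
      have hw' := hw.trans (map_mul _ _ _)
      linear_combination hw' + algebraMap _ _ A₁ * algebraMap _ _ A₂ * hE'
  · rw [hA₁, hA₂, show algebraMap k (RatFunc3 k) a₁ * a₃ = algebraMap k (RatFunc3 k) a₁ *
      (algebraMap k (RatFunc3 k) a₁ * ind k 0 ^ 2 + (algebraMap k (RatFunc3 k) a₂ * ind k 1 ^ 2 +
        algebraMap k (RatFunc3 k) a₁ * algebraMap k (RatFunc3 k) a₂ * ind k 2 ^ 2)) by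
      rw [ha₃, hA₁, hA₂]; ring]
    exact not_isSplitBy h2 ha₁ ha₂ h 0 ha₁ (add_mem
      (mul_mem (hmemA _ _) (pow_mem (hmem _ _ (by decide)) 2))
      (mul_mem (mul_mem (hmemA _ _) (hmemA _ _)) (pow_mem (hmem _ _ (by decide)) 2)))
  · rw [hA₁, hA₂, show algebraMap k (RatFunc3 k) a₂ * a₃ = algebraMap k (RatFunc3 k) a₂ *
      (algebraMap k (RatFunc3 k) a₂ * ind k 1 ^ 2 + (algebraMap k (RatFunc3 k) a₁ * ind k 0 ^ 2 +
        algebraMap k (RatFunc3 k) a₁ * algebraMap k (RatFunc3 k) a₂ * ind k 2 ^ 2)) by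
      rw [ha₃, hA₁, hA₂]; ring]
    exact not_isSplitBy h2 ha₁ ha₂ h 1 ha₂ (add_mem
      (mul_mem (hmemA _ _) (pow_mem (hmem _ _ (by decide)) 2))
      (mul_mem (mul_mem (hmemA _ _) (hmemA _ _)) (pow_mem (hmem _ _ (by decide)) 2)))

end RatFunc3
end

theorem mainTheorem10 :
    -- the general result
    (∀ (F : Type u) [Field F], (2 : F) ≠ 0 → ∀ b c : F, b ≠ 0 → c ≠ 0 → IsQuatDivision b c →
      ∀ (q₁ q₂ q₃ : ℍ[F, b, c]) (a₁ a₂ a₃ : F), SplitCondition q₁ q₂ q₃ a₁ a₂ a₃ →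
      ∀ n : ℕ, Even n → 3 ≤ n →
        -- no improper similitudes
        (¬ ∃ g : Matrix (Fin n) (Fin n) (QuatHat b c n),
          IsImproperSimilitude (F := IterLaurent F n) n
            (genericInvolution (quatSeq q₁ q₂ q₃ n)) g) ∧
        -- the discriminant is the square class of `a₁ * a₂`
        (∀ δ : IterLaurent F n,
          δ ∈ involutionDiscriminant n (genericInvolution (quatSeq q₁ q₂ q₃ n)) ↔
            ∃ u : IterLaurent F n, u ≠ 0 ∧ δ = HahnSeries.C (a₁ * a₂) * u ^ 2) ∧
        -- the discriminant algebra is a quadratic field extension which splits the algebra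
        ∀ δ ∈ involutionDiscriminant (F := IterLaurent F n) n
            (genericInvolution (quatSeq q₁ q₂ q₃ n)),
          ¬ IsSquare δ ∧
          IsSplitBy (IterLaurent F n) (QuatHat b c n) (SqrtField (IterLaurent F n) δ)) ∧
    -- the example over `k(r, s, t)`
    (∀ (k : Type v) [Field k], (2 : k) ≠ 0 → IsSquare (-1 : k) →
      ∀ a₁ a₂ : k, a₁ ≠ 0 → a₂ ≠ 0 → IsQuatDivision a₁ a₂ →
      ∀ A₁ A₂ a₃ : RatFunc3 k,
        A₁ = algebraMap k (RatFunc3 k) a₁ → A₂ = algebraMap k (RatFunc3 k) a₂ →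
        a₃ = A₁ * RatFunc3.ind k 0 ^ 2 + A₂ * RatFunc3.ind k 1 ^ 2
          + A₁ * A₂ * RatFunc3.ind k 2 ^ 2 →
        IsQuatDivision A₁ A₂ ∧
        ∃ q₁ q₂ q₃ : ℍ[RatFunc3 k, A₁, A₂], SplitCondition q₁ q₂ q₃ A₁ A₂ a₃) := by
  refine ⟨?_, ?_⟩
  · intro F _ h2 b c hb hc hdiv q₁ q₂ q₃ a₁ a₂ a₃ hs n hev hn
    refine ⟨fun ⟨g, hg⟩ => not_isImproperSimilitude h2 hb hc hdiv hs hn hev g hg,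
      fun δ => ⟨exists_of_mem_involutionDiscriminant h2 hb hc hs hn hev, ?_⟩, fun δ hδ => ?_⟩
    · rintro ⟨u, hu, rfl⟩
      exact mem_involutionDiscriminant h2 hb hc hs hn hev hu
    · obtain ⟨u, hu, hδu⟩ := exists_of_mem_involutionDiscriminant h2 hb hc hs hn hev hδ
      refine ⟨?_, isSplitBy_discriminant h2 hb hc hs hu hδu⟩
      rw [hδu]
      exact not_isSquare_discriminant h2 hb hc hdiv hs hu
  · intro k _ h2 hneg a₁ a₂ ha₁ ha₂ hdiv A₁ A₂ a₃ hA₁ hA₂ ha₃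
    refine ⟨?_, RatFunc3.exists_splitCondition h2 hneg ha₁ ha₂ hdiv hA₁ hA₂ ha₃⟩
    rw [hA₁, hA₂]
    exact RatFunc3.isQuatDivision hdiv
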